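/- Let $\hbar>0$. Smoothness, smooth manifolds and Lie groups are understood in the sense of convenient calculus (manifolds modelled on convenient vector spaces). Let $Z$ be a coherent manifold, i.e. a smooth manifold with a smooth kernel $K:Z\times Z\to\mathbb C$ all of whose Gram matrices $(K(z_j,z_k))_{jk}$ are Hermitian positive semidefinite and with $K(z,z)>0$ for all $z\in Z$. Let $\overline{\mathbb Q}(Z)$ be a completed quantum space of $Z$: a Hilbert space with vectors $|z\rangle$ ($z\in Z$, the coherent states) that satisfy $\langle z|z'\rangle=K(z,z')$ and whose span $\mathbb Q(Z)$ is dense; let $\mathbb Q^\times(Z)\supseteq\overline{\mathbb Q}(Z)$ be the space of all antilinear functionals on $\mathbb Q(Z)$. Let $\mathbb G$ be a coherent Lie group of $Z$: a Lie group with a smooth involution $A\mapsto A^*$ satisfying $(AB)^*=B^*A^*$, which acts smoothly on $Z$ with $K(z,Az')=K(A^*z,z')$. For $A\in\mathbb G$ let $\Gamma(A)$ be the linear operator on $\mathbb Q(Z)$ with $\Gamma(A)|z\rangle=|Az\rangle$, extended to $\mathbb Q^\times(Z)$ by $\Gamma(A):=\Gamma(A^*)^*$. An element $H\in d\mathbb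 G$ is an infinitesimal generator of a smooth one-parameter group $s\mapsto e^{-isH/\hbar}$ in $\mathbb G$; its adjoint $H^*$ is the generator with $e^{-isH^*/\hbar}=(e^{isH/\hbar})^*$. The quantization of $H$ is $$d\Gamma(H):=i\hbar\,\frac{d}{ds}\Gamma(e^{-isH/\hbar})\Big|_{s=0},$$ a linear operator from $\overline{\mathbb Q}(Z)$ to $\mathbb Q^\times(Z)$ (pointwise derivative of antilinear functionals), and $d\Gamma(\operatorname{Im}H):=\frac1{2i}\bigl(d\Gamma(H)-d\Gamma(H^*)\bigr)$. Let $H(t)\in d\mathbb G$ ($t\in\mathbb R$) be a family satisfying $d\Gamma(\operatorname{Im}H(t))\le 0$ for all $t\ge0$, as a quadratic form on $\mathbb Q(Z)$, and let $z_0\in Z$. Consider the initial value problem for the time-dependent Schrödinger equation $$i\hbar\,\partial_t\psi_t=d\Gamma(H(t))\psi_t\quad(t\ge0),\qquad \psi_0=|z_0\rangle,\tag{1}$$ for families $\psi_t\in\overline{\mathbb Q}(Z)$ that are norm differentiable in $t\ge 0$, and the classical initial value problem $$\dot z(t)=\frac{d}{ds}\,e^{-isH(t)/\hbar}z(t)\Big|_{s=0}\quad(t\ge0),\qquad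 z(0)=z_0,\tag{2}$$ for smooth curves $z$ in $Z$. Then: (a) The problem (1) has at most one solution. (b) If $z$ solves (2), then $\psi_t=|z(t)\rangle$ solves (1), hence is the only solution of (1). (c) If $H(t)$ depends smoothly on $t$ and $\mathbb G$ is finite-dimensional or, more generally, a regular Lie group (each smooth curve in the Lie algebra is the right logarithmic derivative of a smooth curve in $\mathbb G$ that starts at the identity and depends smoothly on parameters), then (2) has a solution $z$, which is unique for $t\ge0$; thus (1) has exactly one solution, and it is the coherent state $\psi_t=|z(t)\rangle$ for all $t\ge0$. -/

import Mathlib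

open Filter Topology Set
open scoped ContDiff ComplexOrder

namespace CoherentManifolds

theorem differentiableAt_of_contDiff_gram {𝓗 : Type*} [NormedAddCommGroup 𝓗]
    [InnerProductSpace ℂ 𝓗] [CompleteSpace 𝓗] (u : ℝ → 𝓗)
    (hk : ContDiff ℝ ∞ (fun p : ℝ × ℝ => inner ℂ (u p.1) (u p.2))) (t : ℝ) :
    DifferentiableAt ℝ u t := by
  set k : ℝ × ℝ → ℂ := fun p => inner ℂ (u p.1) (u p.2) with hkdef
  have hkd : Differentiable ℝ k := hk.differentiable (by simp)
  set ky : ℝ × ℝ → ℂ := fun p => fderiv ℝ k p (0, 1) with hky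
  have hkyc : ContDiff ℝ 1 ky := by
    have h2 : ContDiff ℝ 1 (fderiv ℝ k) := hk.fderiv_right (by norm_cast)
    exact h2.clm_apply contDiff_const
  have hkyd : Differentiable ℝ ky := hkyc.differentiable (by simp)
  set kxy : ℝ × ℝ → ℂ := fun p => fderiv ℝ ky p (1, 0) with hkxy
  have hkxyc : Continuous kxy := (hkyc.continuous_fderiv (by simp)).clm_apply continuous_const
  set M : ℂ := kxy (t, t) with hM
  have dy : ∀ x y, HasDerivAt (fun y => k (x, y)) (ky (x, y)) y := by
    intro x y
    have h1 : HasDerivAt (fun y : ℝ => (x, y)) ((0 : ℝ), (1 : ℝ)) y :=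
      (hasDerivAt_const y x).prodMk (hasDerivAt_id y)
    exact (hkd (x, y)).hasFDerivAt.comp_hasDerivAt y h1
  have dx : ∀ x y, HasDerivAt (fun x => ky (x, y)) (kxy (x, y)) x := by
    intro x y
    have h1 : HasDerivAt (fun x : ℝ => (x, y)) ((1 : ℝ), (0 : ℝ)) x :=
      (hasDerivAt_id x).prodMk (hasDerivAt_const x y)
    exact (hkyd (x, y)).hasFDerivAt.comp_hasDerivAt x h1
  -- second mixed differences of the Gram function
  have key : ∀ ε > 0, ∃ δ > 0, ∀ x ∈ Metric.ball t δ, ∀ y ∈ Metric.ball t δ,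
      ‖k (x, y) - k (t, y) - (k (x, t) - k (t, t)) - ((x - t) * (y - t) : ℝ) * M‖
        ≤ ε * |x - t| * |y - t| := by
    intro ε hε
    obtain ⟨δ, hδ, hb⟩ := Metric.continuous_iff.1 hkxyc (t, t) ε hε
    refine ⟨δ, hδ, fun x hx y hy => ?_⟩
    have htb : t ∈ Metric.ball t δ := Metric.mem_ball_self hδ
    have hyb : ∀ y ∈ Metric.ball t δ,
        ‖ky (x, y) - ky (t, y) - ((x - t : ℝ) : ℂ) * M‖ ≤ ε * |x - t| := by
      intro y hy
      have := Convex.norm_image_sub_le_of_norm_hasDerivWithin_le (𝕜 := ℝ)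
        (f := fun x : ℝ => ky (x, y) - (x : ℂ) * M)
        (f' := fun x : ℝ => kxy (x, y) - M) (s := Metric.ball t δ) (C := ε) (x := t) (y := x)
        (fun w _ => by
          have h1 : HasDerivAt (fun w : ℝ => (w : ℂ) * M) ((1 : ℂ) * M) w :=
            (Complex.ofRealCLM.hasDerivAt (x := w)).mul_const M
          have h2 := ((dx w y).sub h1).hasDerivWithinAt (s := Metric.ball t δ)
          rw [one_mul] at h2
          exact h2)
        (fun w hw => by
          have := hb (w, y) (by
            rw [Prod.dist_eq]; exact max_lt hw hy)
          rw [dist_eq_norm] at this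
          exact this.le)
        (convex_ball t δ) htb hx
      rw [Real.norm_eq_abs] at this
      refine le_trans (le_of_eq ?_) this
      congr 1
      push_cast
      ring
    have := Convex.norm_image_sub_le_of_norm_hasDerivWithin_le (𝕜 := ℝ)
        (f := fun y : ℝ => k (x, y) - k (t, y) - (y : ℂ) * (((x - t : ℝ) : ℂ) * M))
        (f' := fun y : ℝ => ky (x, y) - ky (t, y) - ((x - t : ℝ) : ℂ) * M)
        (s := Metric.ball t δ) (C := ε * |x - t|) (x := t) (y := y)
        (fun w _ => by
          have h1 : HasDerivAt (fun w : ℝ => (w : ℂ) * (((x - t : ℝ) : ℂ) * M))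
              ((1 : ℂ) * (((x - t : ℝ) : ℂ) * M)) w :=
            (Complex.ofRealCLM.hasDerivAt (x := w)).mul_const _
          have h2 := (((dy x w).sub (dy t w)).sub h1).hasDerivWithinAt (s := Metric.ball t δ)
          rw [one_mul] at h2
          exact h2)
        hyb (convex_ball t δ) htb hy
    rw [Real.norm_eq_abs] at this
    refine le_trans (le_of_eq ?_) this
    congr 1
    push_cast
    ring
  have inn : ∀ x y, inner ℂ (slope u t x) (slope u t y)
      = (((x - t)⁻¹ * (y - t)⁻¹ : ℝ) : ℂ) *
        (k (x, y) - k (t, y) - (k (x, t) - k (t, t))) := by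
    intro x y
    simp only [slope, vsub_eq_sub, hkdef]
    rw [← Complex.coe_smul, ← Complex.coe_smul (y - t)⁻¹, inner_smul_left, inner_smul_right,
      inner_sub_left, inner_sub_right, inner_sub_right]
    simp only [Complex.conj_ofReal]
    push_cast
    ring
  have key2 : ∀ ε > 0, ∃ δ > 0, ∀ x ∈ Metric.ball t δ, x ≠ t → ∀ y ∈ Metric.ball t δ, y ≠ t →
      ‖inner ℂ (slope u t x) (slope u t y) - M‖ ≤ ε := by
    intro ε hε
    obtain ⟨δ, hδ, h⟩ := key ε hε
    refine ⟨δ, hδ, fun x hx hxt y hy hyt => ?_⟩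
    have hx0 : x - t ≠ 0 := sub_ne_zero.2 hxt
    have hy0 : y - t ≠ 0 := sub_ne_zero.2 hyt
    have h1 := h x hx y hy
    have e : inner ℂ (slope u t x) (slope u t y) - M = (((x - t)⁻¹ * (y - t)⁻¹ : ℝ) : ℂ) *
        (k (x, y) - k (t, y) - (k (x, t) - k (t, t)) - ((x - t) * (y - t) : ℝ) * M) := by
      have h3 : (((x - t)⁻¹ * (y - t)⁻¹ : ℝ) : ℂ) * (((x - t) * (y - t) : ℝ) : ℂ) = 1 := by
        rw [← Complex.ofReal_mul]
        have : (x - t)⁻¹ * (y - t)⁻¹ * ((x - t) * (y - t)) = 1 := by field_simp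
        rw [this, Complex.ofReal_one]
      rw [inn]
      linear_combination M * h3
    rw [e, norm_mul, Complex.norm_real, Real.norm_eq_abs, abs_mul, abs_inv, abs_inv]
    have hxp : 0 < |x - t| := abs_pos.2 hx0
    have hyp : 0 < |y - t| := abs_pos.2 hy0
    calc |x - t|⁻¹ * |y - t|⁻¹ * _ ≤ |x - t|⁻¹ * |y - t|⁻¹ * (ε * |x - t| * |y - t|) := by gcongr
      _ = ε := by field_simp
  have hc : Cauchy (map (slope u t) (𝓝[≠] t)) := by
    rw [Metric.cauchy_iff]
    refine ⟨inferInstance, fun ε hε => ?_⟩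
    obtain ⟨δ, hδ, h⟩ := key2 (ε ^ 2 / 8) (by positivity)
    refine ⟨slope u t '' (Metric.ball t δ ∩ {t}ᶜ),
      image_mem_map (inter_mem (mem_nhdsWithin_of_mem_nhds (Metric.ball_mem_nhds t hδ))
        self_mem_nhdsWithin), ?_⟩
    rintro _ ⟨x, ⟨hx, hxt⟩, rfl⟩ _ ⟨y, ⟨hy, hyt⟩, rfl⟩
    rw [dist_eq_norm]
    have h1 := h x hx hxt x hx hxt
    have h2 := h x hx hxt y hy hyt
    have h3 := h y hy hyt x hx hxt
    have h4 := h y hy hyt y hy hyt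
    have e : ((‖slope u t x - slope u t y‖ ^ 2 : ℝ) : ℂ)
        = (inner ℂ (slope u t x) (slope u t x) - M) - (inner ℂ (slope u t x) (slope u t y) - M)
          - (inner ℂ (slope u t y) (slope u t x) - M)
          + (inner ℂ (slope u t y) (slope u t y) - M) := by
      have : ((‖slope u t x - slope u t y‖ ^ 2 : ℝ) : ℂ)
          = inner ℂ (slope u t x - slope u t y) (slope u t x - slope u t y) := by
        rw [inner_self_eq_norm_sq_to_K]
        simp
      rw [this, inner_sub_left, inner_sub_right, inner_sub_right]
      ring
    have e2 : ‖slope u t x - slope u t y‖ ^ 2 ≤ ε ^ 2 / 2 := by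
      have : ‖((‖slope u t x - slope u t y‖ ^ 2 : ℝ) : ℂ)‖ = ‖slope u t x - slope u t y‖ ^ 2 := by
        rw [Complex.norm_real, Real.norm_eq_abs, abs_of_nonneg (by positivity)]
      rw [← this, e]
      refine (norm_add_le _ _).trans ?_
      have i1 := norm_sub_le ((inner ℂ (slope u t x) (slope u t x) - M)
        - (inner ℂ (slope u t x) (slope u t y) - M)) (inner ℂ (slope u t y) (slope u t x) - M)
      have i2 := norm_sub_le (inner ℂ (slope u t x) (slope u t x) - M)
        (inner ℂ (slope u t x) (slope u t y) - M)
      linarith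
    refine lt_of_pow_lt_pow_left₀ 2 hε.le ?_
    nlinarith [pow_pos hε 2]
  obtain ⟨v, hv⟩ := cauchy_map_iff_exists_tendsto.1 hc
  exact (hasDerivAt_iff_tendsto_slope.2 hv).differentiableAt

/-! ### Convenient vector spaces and convenient manifolds

Smoothness is the one of convenient calculus. Smooth maps are those that send smooth families with
finitely many real parameters to smooth families; by Boman's theorem it is the same to ask this for
smooth curves only. In a convenient vector space a family is smooth as soon as it is smooth after
composition with every continuous linear functional. -/

/-- The family `p` of points of the locally convex space `E`, with parameters in the open set `U`
of a finite dimensional space, is smooth. -/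
def SmoothFamilyOn {E P : Type*} [AddCommGroup E] [Module ℝ E] [TopologicalSpace E]
    [NormedAddCommGroup P] [NormedSpace ℝ P] (U : Set P) (p : P → E) : Prop :=
  ∀ x ∈ U, ∀ l : E →L[ℝ] ℝ, ContDiffAt ℝ ∞ (fun y => l (p y)) x

/-- The curve `c` in `E` has the velocity `v` at time `t` (limit of difference quotients). -/
def HasVelocity {E : Type*} [AddCommGroup E] [Module ℝ E] [TopologicalSpace E]
    (c : ℝ → E) (v : E) (t : ℝ) : Prop :=
  Tendsto (slope c t) (𝓝[≠] t) (𝓝 v)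

/-- Convenient vector spaces: Hausdorff locally convex spaces in which every scalarwise smooth
curve is differentiable. The velocity of a scalarwise smooth curve is again scalarwise smooth, so
that scalarwise smooth curves then have derivatives of all orders. -/
class ConvenientSpace (E : Type*) [AddCommGroup E] [Module ℝ E] [TopologicalSpace E] : Prop
    extends IsTopologicalAddGroup E, ContinuousSMul ℝ E, LocallyConvexSpace ℝ E, T2Space E where
  exists_velocity : ∀ c : ℝ → E, SmoothFamilyOn univ c → ∀ t, ∃ v, HasVelocity c v t

/-- The subset `D` of `E` is open in the final topology with respect to smooth families. -/
def IsSmoothlyOpen {E : Type*} [AddCommGroup E] [Module ℝ E] [TopologicalSpace E]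
    (D : Set E) : Prop :=
  ∀ (P : Type) [NormedAddCommGroup P] [NormedSpace ℝ P] [FiniteDimensional ℝ P] (p : P → E),
    SmoothFamilyOn univ p → IsOpen (p ⁻¹' D)

/-- The map `f` is smooth on the smoothly open set `D`. -/
def SmoothMapOn {E : Type*} [AddCommGroup E] [Module ℝ E] [TopologicalSpace E]
    (D : Set E) (f : E → E) : Prop :=
  ∀ (P : Type) [NormedAddCommGroup P] [NormedSpace ℝ P] [FiniteDimensional ℝ P] (p : P → E),
    SmoothFamilyOn univ p → SmoothFamilyOn (p ⁻¹' D) (fun y => f (p y))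

/-- A smooth manifold modelled on the convenient vector space `E`: charts with smoothly open images
that cover `Z`, such that the changes of charts are smooth maps between smoothly open sets. -/
class ConvenientManifold (E : Type*) (Z : Type*) [AddCommGroup E] [Module ℝ E]
    [TopologicalSpace E] where
  /-- the charts -/
  charts : Set (PartialEquiv Z E)
  exists_mem_source : ∀ z : Z, ∃ e ∈ charts, z ∈ e.source
  isSmoothlyOpen_target : ∀ e ∈ charts, IsSmoothlyOpen e.target
  isSmoothlyOpen_overlap : ∀ e ∈ charts, ∀ e' ∈ charts, IsSmoothlyOpen (e.symm.trans e').source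
  smooth_change : ∀ e ∈ charts, ∀ e' ∈ charts,
    SmoothMapOn (e.symm.trans e').source (e.symm.trans e')

/-- The family `p` of points of the manifold `Z`, with parameters in a finite dimensional space, is
smooth. For one real parameter, these are the smooth curves in `Z`. -/
def Smooth (E : Type*) {Z P : Type*} [AddCommGroup E] [Module ℝ E] [TopologicalSpace E]
    [ConvenientManifold E Z] [NormedAddCommGroup P] [NormedSpace ℝ P] (p : P → Z) : Prop :=
  ∀ e ∈ ConvenientManifold.charts (E := E) (Z := Z),
    IsOpen (p ⁻¹' e.source) ∧ SmoothFamilyOn (p ⁻¹' e.source) (fun y => e (p y))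

/-- The curves `c` at time `s` and `d` at time `t` pass through the same point of `Z` with the same
velocity there, i.e., they represent the same kinematic tangent vector of `Z`. -/
def SameVelocity (E : Type*) {Z : Type*} [AddCommGroup E] [Module ℝ E] [TopologicalSpace E]
    [ConvenientManifold E Z] (c : ℝ → Z) (s : ℝ) (d : ℝ → Z) (t : ℝ) : Prop :=
  c s = d t ∧ ∃ e ∈ ConvenientManifold.charts (E := E) (Z := Z), c s ∈ e.source ∧
    ∃ v : E, HasVelocity (fun r => e (c r)) v s ∧ HasVelocity (fun r => e (d r)) v t

theorem Smooth.comp {E Z P P' : Type*} [AddCommGroup E] [Module ℝ E] [TopologicalSpace E]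
    [ConvenientManifold E Z] [NormedAddCommGroup P] [NormedSpace ℝ P]
    [NormedAddCommGroup P'] [NormedSpace ℝ P'] {p : P → Z} (hp : Smooth E p) {g : P' → P}
    (hg : ContDiff ℝ ∞ g) : Smooth E (fun y => p (g y)) := by
  intro e he
  obtain ⟨h1, h2⟩ := hp e he
  refine ⟨h1.preimage hg.continuous, fun x hx l => ?_⟩
  exact (h2 (g x) hx l).comp x hg.contDiffAt

theorem smooth_const (E : Type*) {Z P : Type*} [AddCommGroup E] [Module ℝ E] [TopologicalSpace E]
    [ConvenientManifold E Z] [NormedAddCommGroup P] [NormedSpace ℝ P] (z : Z) :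
    Smooth E (fun _ : P => z) := by
  intro e _
  exact ⟨isOpen_const, fun x _ l => contDiffAt_const⟩

/-! ### Coherent manifolds and coherent Lie groups -/

/-- A coherent product that makes the manifold `Z` a coherent manifold. -/
structure CoherentProduct (E Z : Type*) [AddCommGroup E] [Module ℝ E] [TopologicalSpace E]
    [ConvenientManifold E Z] where
  /-- the kernel -/
  K : Z → Z → ℂ
  posSemidef : ∀ (n : ℕ) (z : Fin n → Z), (Matrix.of fun j k => K (z j) (z k)).PosSemidef
  smooth : ∀ (P : Type) [NormedAddCommGroup P] [NormedSpace ℝ P] [FiniteDimensional ℝ P]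
    (p q : P → Z), Smooth E p → Smooth E q → ContDiff ℝ ∞ (fun y => K (p y) (q y))
  pos : ∀ z, 0 < K z z

/-- A Lie group (modelled on the convenient vector space `F`) with a smooth involution `star` that
reverses products. -/
class LieStarGroup (F G : Type*) [AddCommGroup F] [Module ℝ F] [TopologicalSpace F]
    [ConvenientManifold F G] [Group G] [StarMul G] : Prop where
  smooth_mul : ∀ (P : Type) [NormedAddCommGroup P] [NormedSpace ℝ P] [FiniteDimensional ℝ P]
    (p q : P → G), Smooth F p → Smooth F q → Smooth F (fun y => p y * q y)
  smooth_inv : ∀ (P : Type) [NormedAddCommGroup P] [NormedSpace ℝ P] [FiniteDimensional ℝ P]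
    (p : P → G), Smooth F p → Smooth F (fun y => (p y)⁻¹)
  smooth_star : ∀ (P : Type) [NormedAddCommGroup P] [NormedSpace ℝ P] [FiniteDimensional ℝ P]
    (p : P → G), Smooth F p → Smooth F (fun y => star (p y))

/-- The Lie star group `G` acts smoothly on `Z` by coherent maps, and `star A` acts as an adjoint
of `A`. -/
class CoherentLieGroup (F G : Type*) {E Z : Type*} [AddCommGroup F] [Module ℝ F]
    [TopologicalSpace F] [ConvenientManifold F G] [Group G] [StarMul G] [AddCommGroup E]
    [Module ℝ E] [TopologicalSpace E] [ConvenientManifold E Z] [MulAction G Z]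
    (K : CoherentProduct E Z) : Prop extends LieStarGroup F G where
  smooth_smul : ∀ (P : Type) [NormedAddCommGroup P] [NormedSpace ℝ P] [FiniteDimensional ℝ P]
    (p : P → G) (q : P → Z), Smooth F p → Smooth E q → Smooth E (fun y => p y • q y)
  adjoint : ∀ (A : G) (z z' : Z), K.K z (A • z') = K.K (star A • z) z'

/-- An infinitesimal generator `H` in `dG`, given by its one-parameter group
`H.exp s = e ^ (-i s H / ħ)` in `G`. -/
structure Generator (F G : Type*) [AddCommGroup F] [Module ℝ F] [TopologicalSpace F]
    [ConvenientManifold F G] [Group G] where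
  /-- the one-parameter group `s ↦ e ^ (-i s H / ħ)` -/
  exp : ℝ → G
  smooth : Smooth F exp
  exp_add : ∀ s t, exp (s + t) = exp s * exp t

/-- The adjoint generator `H*`, with `e ^ (-i s H* / ħ) = (e ^ (i s H / ħ))*`. -/
def Generator.adjoint {F G : Type*} [AddCommGroup F] [Module ℝ F] [TopologicalSpace F]
    [ConvenientManifold F G] [Group G] [StarMul G] [LieStarGroup F G] (H : Generator F G) :
    Generator F G where
  exp s := star (H.exp (-s))
  smooth := LieStarGroup.smooth_star ℝ _ (H.smooth.comp contDiff_neg)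
  exp_add s t := by
    rw [← star_mul, ← H.exp_add]
    congr 2
    ring

/-- The family `t ↦ H t` of generators depends smoothly on `t`: in a chart of `G` at the identity,
the initial velocities `-i H t / ħ` of the one-parameter groups form a smooth curve in the model
space. -/
def SmoothGenerators {F G : Type*} [AddCommGroup F] [Module ℝ F] [TopologicalSpace F]
    [ConvenientManifold F G] [Group G] (H : ℝ → Generator F G) : Prop :=
  ∃ e ∈ ConvenientManifold.charts (E := F) (Z := G), (1 : G) ∈ e.source ∧ ∃ v : ℝ → F,
    (∀ t, HasVelocity (fun s => e ((H t).exp s)) (v t) 0) ∧ SmoothFamilyOn univ v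

/-- `G` is a regular Lie group: every smooth curve `X` in the Lie algebra (velocities at the identity,
read in a chart `e`) is the right logarithmic derivative of a smooth curve in `G` that starts at the
identity, and this curve can be chosen smoothly in all parameters `y` on which `X` depends
smoothly. -/
def IsRegularLieGroup (F G : Type*) [AddCommGroup F] [Module ℝ F] [TopologicalSpace F]
    [ConvenientManifold F G] [Group G] : Prop :=
  ∀ e ∈ ConvenientManifold.charts (E := F) (Z := G), (1 : G) ∈ e.source →
    ∀ (P : Type) [NormedAddCommGroup P] [NormedSpace ℝ P] [FiniteDimensional ℝ P]
      (X : P × ℝ → F), SmoothFamilyOn univ X → ∃ g : P × ℝ → G, Smooth F g ∧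
        ∀ y, g (y, 0) = 1 ∧
          ∀ t, HasVelocity (fun s => e (g (y, t + s) * (g (y, t))⁻¹)) (X (y, t)) 0

/-! ### Quantum spaces and quantization -/

/-- The Hilbert space `V` is a completed quantum space of the coherent manifold `Z`, with coherent
states `ket z`. -/
structure QuantumSpace {E Z : Type*} [AddCommGroup E] [Module ℝ E] [TopologicalSpace E]
    [ConvenientManifold E Z] (K : CoherentProduct E Z) (V : Type*) [NormedAddCommGroup V]
    [InnerProductSpace ℂ V] where
  /-- the coherent states -/
  ket : Z → V
  inner_ket : ∀ z z', inner ℂ (ket z) (ket z') = K.K z z'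
  dense : Dense (Submodule.span ℂ (range ket) : Set V)

namespace QuantumSpace

variable {E Z : Type*} [AddCommGroup E] [Module ℝ E] [TopologicalSpace E]
  [ConvenientManifold E Z] {K : CoherentProduct E Z} {V : Type*} [NormedAddCommGroup V]
  [InnerProductSpace ℂ V]

/-- The quantum space: the algebraic span of the coherent states. -/
abbrev carrier (Q : QuantumSpace K V) : Submodule ℂ V := Submodule.span ℂ (range Q.ket)

/-- The augmented quantum space: all antilinear functionals on the quantum space. -/
abbrev Augmented (Q : QuantumSpace K V) : Type _ := Q.carrier →ₛₗ[starRingEnd ℂ] ℂ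

/-- The coherent state as a vector of the quantum space. -/
def coherentState (Q : QuantumSpace K V) (z : Z) : Q.carrier :=
  ⟨Q.ket z, Submodule.subset_span (mem_range_self z)⟩

/-- The embedding of the completed quantum space into the augmented quantum space. -/
noncomputable def toAugmented (Q : QuantumSpace K V) : V →ₗ[ℂ] Q.Augmented where
  toFun ψ :=
    { toFun := fun v => inner ℂ (v : V) ψ
      map_add' := fun v w => by rw [Submodule.coe_add, inner_add_left]
      map_smul' := fun a v => by rw [Submodule.coe_smul, inner_smul_left, smul_eq_mul] }
  map_add' ψ φ := by
    ext v
    exact inner_add_right _ _ _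
  map_smul' a ψ := by
    ext v
    exact inner_smul_right _ _ _

variable {F G : Type*} [AddCommGroup F] [Module ℝ F] [TopologicalSpace F]
  [ConvenientManifold F G] [Group G] [StarMul G] [MulAction G Z]

theorem inner_ket_linearCombination (Q : QuantumSpace K V)
    (hG : ∀ (A : G) (z z' : Z), K.K z (A • z') = K.K (star A • z) z') (A : G) (z : Z)
    (c : Z →₀ ℂ) :
    inner ℂ (Q.ket z) (Finsupp.linearCombination ℂ (fun w => Q.ket (A • w)) c)
      = inner ℂ (Q.ket (star A • z)) (Finsupp.linearCombination ℂ Q.ket c) := by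
  simp only [Finsupp.linearCombination_apply, Finsupp.sum, inner_sum, inner_smul_right,
    Q.inner_ket, hG]

theorem linearCombination_congr (Q : QuantumSpace K V)
    (hG : ∀ (A : G) (z z' : Z), K.K z (A • z') = K.K (star A • z) z') (A : G) (c d : Z →₀ ℂ)
    (h : Finsupp.linearCombination ℂ Q.ket c = Finsupp.linearCombination ℂ Q.ket d) :
    Finsupp.linearCombination ℂ (fun w => Q.ket (A • w)) c
      = Finsupp.linearCombination ℂ (fun w => Q.ket (A • w)) d := by
  rw [← sub_eq_zero]
  refine Q.dense.eq_zero_of_inner_right ℂ fun v hv => ?_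
  refine Submodule.span_induction (p := fun v _ => inner ℂ v _ = (0 : ℂ)) ?_ ?_ ?_ ?_ hv
  · rintro _ ⟨z, rfl⟩
    rw [inner_sub_right, inner_ket_linearCombination Q hG, inner_ket_linearCombination Q hG, h,
      sub_self]
  · exact inner_zero_left _
  · intro x y _ _ hx hy
    rw [inner_add_left, hx, hy, add_zero]
  · intro a x _ hx
    rw [inner_smul_left, hx, mul_zero]

theorem exists_linearCombination (Q : QuantumSpace K V) (v : Q.carrier) :
    ∃ c : Z →₀ ℂ, Finsupp.linearCombination ℂ Q.ket c = v :=
  Finsupp.mem_span_range_iff_exists_finsupp.1 v.2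

variable (F) in
/-- The quantization of the coherent map `A`: the linear operator on the quantum space that maps
each coherent state of label `z` to the one of label `A • z`. -/
noncomputable def Gamma [CoherentLieGroup F G K] (Q : QuantumSpace K V) (A : G) :
    Q.carrier →ₗ[ℂ] Q.carrier where
  toFun v := ⟨Finsupp.linearCombination ℂ (fun w => Q.ket (A • w))
      (Q.exists_linearCombination v).choose, by
    rw [Finsupp.linearCombination_apply]
    exact Submodule.sum_mem _ fun w _ =>
      Submodule.smul_mem _ _ (Submodule.subset_span (mem_range_self (A • w)))⟩
  map_add' v w := by
    apply Subtype.ext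
    refine Eq.trans ?_ (map_add (Finsupp.linearCombination ℂ (fun w => Q.ket (A • w))) _ _)
    refine Q.linearCombination_congr (CoherentLieGroup.adjoint F (K := K)) A _ _ ?_
    rw [map_add, (Q.exists_linearCombination v).choose_spec,
      (Q.exists_linearCombination w).choose_spec, (Q.exists_linearCombination _).choose_spec,
      Submodule.coe_add]
  map_smul' a v := by
    apply Subtype.ext
    refine Eq.trans ?_ (map_smul (Finsupp.linearCombination ℂ (fun w => Q.ket (A • w))) a _)
    refine Q.linearCombination_congr (CoherentLieGroup.adjoint F (K := K)) A _ _ ?_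
    rw [map_smul, (Q.exists_linearCombination v).choose_spec,
      (Q.exists_linearCombination _).choose_spec, Submodule.coe_smul]

theorem Gamma_coherentState [CoherentLieGroup F G K] (Q : QuantumSpace K V) (A : G) (z : Z) :
    Q.Gamma F A (Q.coherentState z) = Q.coherentState (A • z) := by
  ext
  have h := Q.linearCombination_congr (CoherentLieGroup.adjoint F (K := K)) A
    (Q.exists_linearCombination (Q.coherentState z)).choose (Finsupp.single z 1) (by
      rw [(Q.exists_linearCombination _).choose_spec, Finsupp.linearCombination_single, one_smul]
      rfl)
  rw [Finsupp.linearCombination_single, one_smul] at h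
  exact h

variable (F) in
/-- The extension of the quantization of `A` to the augmented quantum space, defined through
the adjoint map. -/
noncomputable def GammaAugmented [CoherentLieGroup F G K] (Q : QuantumSpace K V) (A : G) :
    Q.Augmented →ₗ[ℂ] Q.Augmented where
  toFun Φ := Φ.comp (Q.Gamma F (star A))
  map_add' _ _ := rfl
  map_smul' _ _ := rfl

theorem differentiableAt_GammaAugmented [CompleteSpace V] [CoherentLieGroup F G K]
    (Q : QuantumSpace K V) (H : Generator F G) (ψ : V) (v : Q.carrier) :
    DifferentiableAt ℝ (fun s => Q.GammaAugmented F (H.exp s) (Q.toAugmented ψ) v) 0 := by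
  have : LieStarGroup F G := CoherentLieGroup.toLieStarGroup K
  obtain ⟨v, hv⟩ := v
  refine Submodule.span_induction (p := fun v hv => DifferentiableAt ℝ
    (fun s => Q.GammaAugmented F (H.exp s) (Q.toAugmented ψ) ⟨v, hv⟩) 0) ?_ ?_ ?_ ?_ hv
  · rintro _ ⟨z, rfl⟩
    have hs : Smooth E (fun s : ℝ => star (H.exp s) • z) :=
      CoherentLieGroup.smooth_smul K ℝ _ _ (LieStarGroup.smooth_star ℝ _ H.smooth)
        (smooth_const E z)
    have hd := differentiableAt_of_contDiff_gram (fun s : ℝ => Q.ket (star (H.exp s) • z)) (by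
      simp only [Q.inner_ket]
      exact K.smooth (ℝ × ℝ) _ _ (hs.comp contDiff_fst) (hs.comp contDiff_snd)) 0
    have e : (fun s => Q.GammaAugmented F (H.exp s) (Q.toAugmented ψ)
        ⟨Q.ket z, Submodule.subset_span (mem_range_self z)⟩)
        = fun s => inner ℂ (Q.ket (star (H.exp s) • z)) ψ := by
      funext s
      change inner ℂ (Q.Gamma F (star (H.exp s)) (Q.coherentState z) : V) ψ = _
      rw [Gamma_coherentState]
      rfl
    rw [e]
    exact hd.inner ℂ (differentiableAt_const ψ)
  · have e : (fun s => Q.GammaAugmented F (H.exp s) (Q.toAugmented ψ)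
        ⟨0, Submodule.zero_mem _⟩) = fun _ => 0 := by
      funext s
      exact map_zero _
    rw [e]
    exact differentiableAt_const 0
  · intro x y hx hy h1 h2
    have e : (fun s => Q.GammaAugmented F (H.exp s) (Q.toAugmented ψ)
        ⟨x + y, Submodule.add_mem _ hx hy⟩)
        = (fun s => Q.GammaAugmented F (H.exp s) (Q.toAugmented ψ) ⟨x, hx⟩)
          + fun s => Q.GammaAugmented F (H.exp s) (Q.toAugmented ψ) ⟨y, hy⟩ := by
      funext s
      exact map_add _ (⟨x, hx⟩ : Q.carrier) ⟨y, hy⟩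
    rw [e]
    exact h1.add h2
  · intro a x hx h1
    have e : (fun s => Q.GammaAugmented F (H.exp s) (Q.toAugmented ψ)
        ⟨a • x, Submodule.smul_mem _ a hx⟩)
        = fun s => (starRingEnd ℂ a) *
          Q.GammaAugmented F (H.exp s) (Q.toAugmented ψ) ⟨x, hx⟩ := by
      funext s
      exact LinearMap.map_smulₛₗ _ a (⟨x, hx⟩ : Q.carrier)
    rw [e]
    exact h1.const_mul _

/-- The quantization of a generator: the derivative `i ħ (d/ds) Γ(e ^ (-i s H / ħ))` at `s = 0`,
as a linear operator from the completed quantum space to the augmented quantum space. The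
derivative is taken in the topology of pointwise convergence of antilinear functionals. -/
noncomputable def dGamma [CompleteSpace V] [CoherentLieGroup F G K] (Q : QuantumSpace K V)
    (hbar : ℝ) (H : Generator F G) : V →ₗ[ℂ] Q.Augmented where
  toFun ψ :=
    { toFun := fun v => Complex.I * hbar *
        deriv (fun s => Q.GammaAugmented F (H.exp s) (Q.toAugmented ψ) v) 0
      map_add' := fun v w => by
        simp only [map_add]
        rw [deriv_fun_add (Q.differentiableAt_GammaAugmented H ψ v)
          (Q.differentiableAt_GammaAugmented H ψ w), mul_add]
      map_smul' := fun a v => by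
        simp only [LinearMap.map_smulₛₗ, smul_eq_mul]
        rw [deriv_const_mul _ (Q.differentiableAt_GammaAugmented H ψ v)]
        ring }
  map_add' ψ φ := by
    ext v
    simp only [map_add, LinearMap.coe_mk, AddHom.coe_mk, LinearMap.add_apply]
    rw [deriv_fun_add (Q.differentiableAt_GammaAugmented H ψ v)
      (Q.differentiableAt_GammaAugmented H φ v), mul_add]
  map_smul' a ψ := by
    ext v
    simp only [map_smul, LinearMap.coe_mk, AddHom.coe_mk, LinearMap.smul_apply, smul_eq_mul,
      RingHom.id_apply]
    rw [deriv_const_mul _ (Q.differentiableAt_GammaAugmented H ψ v)]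
    ring

/-- The quantization of the imaginary part `(H - H*) / (2 i)` of a generator `H`. -/
noncomputable def dGammaIm [CompleteSpace V] [CoherentLieGroup F G K] (Q : QuantumSpace K V)
    (hbar : ℝ) (H : Generator F G) : V →ₗ[ℂ] Q.Augmented :=
  haveI : LieStarGroup F G := CoherentLieGroup.toLieStarGroup K
  (2 * Complex.I)⁻¹ • (Q.dGamma hbar H - Q.dGamma hbar H.adjoint)

/-- The family `ψ` of vectors of the completed quantum space solves the initial value problem
`i ħ ∂ψ/∂t = dΓ(H t) ψ` for `t ≥ 0`, with initial value `ψ₀`. The derivative of `ψ` exists in norm;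
the equation is one between elements of the augmented quantum space. -/
def IsSchrodingerSolution [CompleteSpace V] [CoherentLieGroup F G K] (Q : QuantumSpace K V)
    (hbar : ℝ) (H : ℝ → Generator F G) (ψ₀ : V) (ψ : ℝ → V) : Prop :=
  ψ 0 = ψ₀ ∧ ∀ t ≥ 0, ∃ ψt' : V, HasDerivWithinAt ψ ψt' (Ici 0) t ∧
    (Complex.I * hbar) • Q.toAugmented ψt' = Q.dGamma hbar (H t) (ψ t)

end QuantumSpace

/-- The smooth curve `z` in `Z` solves the classical initial value problem for `t ≥ 0`: its velocity
at time `t` is the value at `z t` of the vector field on `Z` that generates the one-parameter group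
`s ↦ e ^ (-i s H t / ħ)`. -/
def IsTrajectory (E : Type*) {F G Z : Type*} [AddCommGroup E] [Module ℝ E] [TopologicalSpace E]
    [ConvenientManifold E Z] [AddCommGroup F] [Module ℝ F] [TopologicalSpace F]
    [ConvenientManifold F G] [Group G] [MulAction G Z] (H : ℝ → Generator F G) (z₀ : Z)
    (z : ℝ → Z) : Prop :=
  Smooth E z ∧ z 0 = z₀ ∧ ∀ t ≥ 0, SameVelocity E z t (fun s => (H t).exp s • z t) 0

end CoherentManifolds

open CoherentManifolds

namespace CoherentManifolds

/-! Uniqueness in (1) is an energy estimate: the difference `δ` of two solutions satisfies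
`(d/dt)‖δ‖² = 2 Re ⟨δ, χ⟩` with `iħχ = dΓ(H)δ`, so `Re ⟨δ, χ⟩ ≤ 0` is wanted. Dissipativity is given
only on the span of the coherent states, whereas `δ` is an arbitrary vector on which `dΓ(H)` has a
value in the Hilbert space. The bridge (`re_inner_nonpos_of_dGamma_eq`) is that dissipativity makes
`Γ(exp s)` and its adjoint contractions of the span for `s ≥ 0`; integrating the weak equation over
a short time that does not depend on the test vector gives an inequality that is continuous in the
test vector, and by density the test vector may be replaced by `δ` itself.

For (b), smoothness of the kernel makes `|z(t)⟩` norm differentiable, and testing (1) against `⟨w|`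
turns it into an equality of derivatives of `K(w, ·)` along two curves with the same velocity. The
point to prove is that a velocity in one chart determines the derivative of a function known to be
differentiable only along smooth families (`deriv_along_eq`); Hadamard's lemma supplies a
two-parameter family that interpolates between a curve and its tangent line.

For (c), the equation is solved in the group: if `g` satisfies it there and `g(0) = 1`, then
`g(t)z₀` solves (2). In a regular group `g` exists by definition. In finite dimension
Picard–Lindelöf gives local solutions, which are glued by right translation. Any trajectory `z'` has
`g⁻¹z'` constant (`IsTrajectoryOn.inv_smul_eq`), which yields both the gluing and the uniqueness in
(2). -/

/-! ### Hadamard's lemma and cut-offs of parameters. -/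

theorem hasDerivAt_integral_pow_mul_comp_mul {g : ℝ → ℝ} (hg : ContDiff ℝ ∞ g) (k : ℕ) (r : ℝ) :
    HasDerivAt (fun r => ∫ u in (0 : ℝ)..1, u ^ k * g (r * u))
      (∫ u in (0 : ℝ)..1, u ^ (k + 1) * deriv g (r * u)) r := by
  have hg' : Continuous (deriv g) := hg.continuous_deriv (by simp)
  have hc : Continuous (fun p : ℝ × ℝ => p.2 ^ (k + 1) * deriv g (p.1 * p.2)) := by fun_prop
  obtain ⟨C, hC⟩ := ((isCompact_Icc (a := r - 1) (b := r + 1)).prod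
    (isCompact_Icc (a := (0 : ℝ)) (b := 1))).exists_bound_of_continuousOn hc.continuousOn
  refine (intervalIntegral.hasDerivAt_integral_of_dominated_loc_of_deriv_le
    (μ := MeasureTheory.volume) (a := 0) (b := 1) (F := fun r u => u ^ k * g (r * u))
    (F' := fun r u => u ^ (k + 1) * deriv g (r * u)) (bound := fun _ => C)
    (s := Ioo (r - 1) (r + 1)) (Ioo_mem_nhds (by linarith) (by linarith)) ?_ ?_ ?_ ?_ ?_ ?_).2
  · refine .of_forall fun x => ?_
    have : Continuous fun u => u ^ k * g (x * u) := by
      have := hg.continuous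
      fun_prop
    exact this.aestronglyMeasurable
  · have : Continuous fun u => u ^ k * g (r * u) := by
      have := hg.continuous
      fun_prop
    exact this.intervalIntegrable _ _
  · have : Continuous fun u => u ^ (k + 1) * deriv g (r * u) := by fun_prop
    exact this.aestronglyMeasurable
  · refine .of_forall fun u hu x hx => hC (x, u) ⟨Ioo_subset_Icc_self hx, ?_⟩
    rw [uIoc_of_le zero_le_one] at hu
    exact Ioc_subset_Icc_self hu
  · exact intervalIntegrable_const
  · refine .of_forall fun u _ x _ => ?_
    have h1 : HasDerivAt (fun x : ℝ => x * u) u x := hasDerivAt_mul_const u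
    have h2 := (((hg.differentiable (by simp)) (x * u)).hasDerivAt.comp x h1).const_mul (u ^ k)
    exact h2.congr_deriv (by ring)

/-- The factor `u ^ k` closes the induction: differentiating under the integral gives an integral of
the same form with `deriv g` and `k + 1`. Only `k = 0` is used afterwards. -/
theorem contDiff_integral_pow_mul_comp_mul {g : ℝ → ℝ} (hg : ContDiff ℝ ∞ g) (k : ℕ) :
    ContDiff ℝ ∞ (fun r => ∫ u in (0 : ℝ)..1, u ^ k * g (r * u)) := by
  rw [contDiff_infty]
  intro n
  induction n generalizing g k with
  | zero =>
    rw [Nat.cast_zero, contDiff_zero]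
    exact continuous_iff_continuousAt.2 fun r =>
      (hasDerivAt_integral_pow_mul_comp_mul hg k r).continuousAt
  | succ n ih =>
    push_cast
    rw [contDiff_succ_iff_deriv]
    refine ⟨fun r => (hasDerivAt_integral_pow_mul_comp_mul hg k r).differentiableAt, by simp, ?_⟩
    have e : deriv (fun r => ∫ u in (0 : ℝ)..1, u ^ k * g (r * u))
        = fun r => ∫ u in (0 : ℝ)..1, u ^ (k + 1) * deriv g (r * u) :=
      funext fun r => (hasDerivAt_integral_pow_mul_comp_mul hg k r).deriv
    rw [e]
    exact ih ((contDiff_infty_iff_deriv.1 hg).2) (k + 1)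

/-- Hadamard's lemma in one variable. -/
theorem contDiff_dslope_zero {g : ℝ → ℝ} (hg : ContDiff ℝ ∞ g) : ContDiff ℝ ∞ (dslope g 0) := by
  have hg' : ContDiff ℝ ∞ (deriv g) := (contDiff_infty_iff_deriv.1 hg).2
  have e : dslope g 0 = fun r => ∫ u in (0 : ℝ)..1, u ^ 0 * deriv g (r * u) := by
    funext r
    rcases eq_or_ne r 0 with rfl | hr
    · simp
    · rw [dslope_of_ne _ hr, slope_def_field]
      simp only [pow_zero, one_mul]
      rw [intervalIntegral.integral_comp_mul_left _ hr,
        intervalIntegral.integral_deriv_eq_sub (fun x _ => hg.differentiable (by simp) x)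
          (hg'.continuous.intervalIntegrable _ _)]
      simp only [mul_zero, mul_one, sub_zero, smul_eq_mul]
      field_simp
  rw [e]
  exact contDiff_integral_pow_mul_comp_mul hg' 0

/-- Smooth openness and smoothness of maps are tested on families defined on the whole parameter
space. Precomposing with `χ` turns a family that is good only on `N` into such a family, without
changing it near `x₀`. -/
theorem exists_contDiff_cutoff {P : Type*} [NormedAddCommGroup P] [NormedSpace ℝ P]
    [FiniteDimensional ℝ P] {x₀ : P} {N : Set P} (hN : N ∈ 𝓝 x₀) :
    ∃ χ : P → P, ContDiff ℝ ∞ χ ∧ (∀ᶠ x in 𝓝 x₀, χ x = x) ∧ ∀ x, χ x ∈ N := by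
  obtain ⟨δ, hδ, hb⟩ := Metric.mem_nhds_iff.1 hN
  let b : ContDiffBump x₀ := ⟨δ / 2, δ, by positivity, by linarith⟩
  refine ⟨fun x => x₀ + b x • (x - x₀), ?_, ?_, fun x => ?_⟩
  · exact contDiff_const.add (b.contDiff.smul (contDiff_id.sub contDiff_const))
  · filter_upwards [b.eventuallyEq_one] with x hx
    rw [hx]
    simp
  · apply hb
    rw [Metric.mem_ball, dist_eq_norm, add_sub_cancel_left, norm_smul, Real.norm_eq_abs,
      abs_of_nonneg b.nonneg]
    by_cases hx : dist x x₀ < δ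
    · rw [dist_eq_norm] at hx
      calc b x * ‖x - x₀‖ ≤ 1 * ‖x - x₀‖ := by
            gcongr
            exact b.le_one
        _ < δ := by rwa [one_mul]
    · have : b x = 0 := b.zero_of_le_dist (not_lt.1 hx)
      rw [this, zero_mul]
      exact hδ

/-! ### Velocities in locally convex spaces. -/

section LocallyConvex

variable {E : Type*} [AddCommGroup E] [Module ℝ E] [TopologicalSpace E]

theorem SmoothFamilyOn.comp {P P' : Type*} [NormedAddCommGroup P] [NormedSpace ℝ P]
    [NormedAddCommGroup P'] [NormedSpace ℝ P'] {U : Set P} {U' : Set P'} {p : P → E}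
    (hp : SmoothFamilyOn U p) {g : P' → P} (hg : ContDiff ℝ ∞ g) (hm : MapsTo g U' U) :
    SmoothFamilyOn U' (fun y => p (g y)) :=
  fun x hx l => (hp (g x) (hm hx) l).comp x hg.contDiffAt

theorem HasVelocity.congr {c d : ℝ → E} {v : E} {t : ℝ} (h : HasVelocity c v t)
    (hcd : c =ᶠ[𝓝 t] d) : HasVelocity d v t := by
  refine Tendsto.congr' ?_ h
  filter_upwards [hcd.filter_mono nhdsWithin_le_nhds] with x hx
  simp only [slope, hx, hcd.eq_of_nhds]

theorem hasVelocity_iff_shift {c : ℝ → E} {v : E} {t : ℝ} :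
    HasVelocity c v t ↔ HasVelocity (fun s => c (t + s)) v 0 := by
  have e : 𝓝[≠] t = map (fun s => t + s) (𝓝[≠] 0) := by
    simp
  unfold HasVelocity
  rw [e, tendsto_map'_iff]
  refine tendsto_congr fun s => ?_
  simp [slope]

theorem HasVelocity.hasDerivAt {c : ℝ → E} {v : E} {t : ℝ} (h : HasVelocity c v t)
    (l : E →L[ℝ] ℝ) : HasDerivAt (fun s => l (c s)) (l v) t := by
  rw [hasDerivAt_iff_tendsto_slope]
  refine ((l.continuous.tendsto v).comp h).congr fun s => ?_
  simp [slope]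

theorem HasVelocity.deriv {c : ℝ → E} {v : E} {t : ℝ} (h : HasVelocity c v t)
    (l : E →L[ℝ] ℝ) : deriv (fun s => l (c s)) t = l v :=
  (h.hasDerivAt l).deriv

theorem eq_of_forall_dual_eq [ConvenientSpace E] {x y : E} (h : ∀ l : E →L[ℝ] ℝ, l x = l y) :
    x = y := by
  by_contra hne
  obtain ⟨l, hl⟩ := geometric_hahn_banach_point_point (E := E) hne
  exact hl.ne (h l)

/-- A curve that is smooth near `t` has a velocity at `t`. -/
theorem exists_hasVelocity [ConvenientSpace E] {c : ℝ → E} {U : Set ℝ} {t : ℝ} (hU : U ∈ 𝓝 t)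
    (hc : SmoothFamilyOn U c) : ∃ v, HasVelocity c v t := by
  obtain ⟨χ, hχ, hχ1, hχ2⟩ := exists_contDiff_cutoff hU
  obtain ⟨v, hv⟩ := ConvenientSpace.exists_velocity _ (hc.comp hχ fun x (_ : x ∈ univ) => hχ2 x) t
  refine ⟨v, hv.congr ?_⟩
  filter_upwards [hχ1] with x hx
  rw [hx]

/-- Smoothness is scalarwise: after a functional is applied, the difference quotient completed by
the velocity becomes a scalar `dslope`, to which Hadamard's lemma applies. -/
theorem smoothFamilyOn_update_slope {c : ℝ → E} {v : E} (hc : SmoothFamilyOn univ c)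
    (hv : HasVelocity c v 0) : SmoothFamilyOn univ (Function.update (slope c 0) 0 v) := by
  intro s _ l
  have e : (fun s => l (Function.update (slope c 0) 0 v s)) = dslope (fun s => l (c s)) 0 := by
    funext r
    rcases eq_or_ne r 0 with rfl | hr
    · simp [hv.deriv l]
    · rw [Function.update_of_ne hr, dslope_of_ne _ hr]
      simp [slope]
  rw [e]
  exact (contDiff_dslope_zero (contDiff_iff_contDiffAt.2 fun x => hc x trivial l)).contDiffAt

end LocallyConvex

/-! ### Tangent vectors of convenient manifolds and derivatives along curves. -/

section Manifold

variable {E : Type*} [AddCommGroup E] [Module ℝ E] [TopologicalSpace E]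
  {Z : Type*} [ConvenientManifold E Z]
  {E' : Type*} [AddCommGroup E'] [Module ℝ E'] [TopologicalSpace E']
  {Z' : Type*} [ConvenientManifold E' Z']

theorem Smooth.congr_of_eventuallyEq {P : Type*} [NormedAddCommGroup P] [NormedSpace ℝ P]
    {p : P → Z} (h : ∀ x, ∃ q : P → Z, Smooth E q ∧ p =ᶠ[𝓝 x] q) : Smooth E p := by
  intro e he
  refine ⟨isOpen_iff_mem_nhds.2 fun x hx => ?_, fun x hx l => ?_⟩
  · obtain ⟨q, hq, hpq⟩ := h x
    have hx' : q x ∈ e.source := hpq.eq_of_nhds ▸ hx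
    filter_upwards [hpq, (hq e he).1.mem_nhds hx'] with y hy hy'
    rw [mem_preimage, hy]
    exact hy'
  · obtain ⟨q, hq, hpq⟩ := h x
    have hx' : q x ∈ e.source := hpq.eq_of_nhds ▸ hx
    refine ((hq e he).2 x hx' l).congr_of_eventuallyEq ?_
    filter_upwards [hpq] with y hy
    rw [hy]

theorem smooth_symm_comp {P : Type} [NormedAddCommGroup P] [NormedSpace ℝ P]
    [FiniteDimensional ℝ P] {e : PartialEquiv Z E} (he : e ∈ ConvenientManifold.charts)
    {q : P → E} (hq : SmoothFamilyOn univ q) (hm : ∀ x, q x ∈ e.target) :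
    Smooth E (fun x => e.symm (q x)) := by
  intro e' he'
  have hs : (fun x => e.symm (q x)) ⁻¹' e'.source = q ⁻¹' (e.symm.trans e').source := by
    ext x
    simp [hm x]
  rw [hs]
  exact ⟨ConvenientManifold.isSmoothlyOpen_overlap e he e' he' P q hq,
    ConvenientManifold.smooth_change e he e' he' P q hq⟩

/-- A family that is smooth in a chart near `x₀` agrees near `x₀` with a smooth family. -/
theorem exists_smooth_eventuallyEq {P : Type} [NormedAddCommGroup P] [NormedSpace ℝ P]
    [FiniteDimensional ℝ P] {e : PartialEquiv Z E} (he : e ∈ ConvenientManifold.charts)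
    {q : P → E} {U : Set P} {x₀ : P} (hU : U ∈ 𝓝 x₀) (hq : SmoothFamilyOn U q)
    (hm : q x₀ ∈ e.target) :
    ∃ p : P → Z, Smooth E p ∧ ∀ᶠ x in 𝓝 x₀, p x = e.symm (q x) := by
  obtain ⟨χ, hχ, hχ1, hχ2⟩ := exists_contDiff_cutoff hU
  have hq' : SmoothFamilyOn univ (fun x => q (χ x)) := hq.comp hχ fun x _ => hχ2 x
  have hN : (fun x => q (χ x)) ⁻¹' e.target ∈ 𝓝 x₀ := by
    refine (ConvenientManifold.isSmoothlyOpen_target e he P _ hq').mem_nhds ?_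
    rw [mem_preimage, hχ1.self_of_nhds]
    exact hm
  -- Two cut-offs are needed: `χ` makes the family smooth everywhere, and only then is the set where
  -- it stays in the chart image known to be open, so that `ξ` can confine it there.
  obtain ⟨ξ, hξ, hξ1, hξ2⟩ := exists_contDiff_cutoff hN
  refine ⟨fun x => e.symm (q (χ (ξ x))),
    smooth_symm_comp he (hq'.comp hξ (mapsTo_univ _ _)) hξ2, ?_⟩
  filter_upwards [hχ1, hξ1] with x h1 h2
  rw [h2, h1]

variable (E) in
/-- The function `f` is differentiable at the point `z` along all smooth families through `z`. -/
def DifferentiableAlong {W : Type*} [NormedAddCommGroup W] [NormedSpace ℝ W] (f : Z → W) (z : Z) :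
    Prop :=
  ∀ (P : Type) [NormedAddCommGroup P] [NormedSpace ℝ P] [FiniteDimensional ℝ P] (p : P → Z),
    Smooth E p → ∀ x, p x = z → DifferentiableAt ℝ (fun y => f (p y)) x

variable (E E') in
/-- The map `φ` between manifolds sends smooth families to smooth families. -/
def SmoothMap (φ : Z → Z') : Prop :=
  ∀ (P : Type) [NormedAddCommGroup P] [NormedSpace ℝ P] [FiniteDimensional ℝ P] (p : P → Z),
    Smooth E p → Smooth E' (fun y => φ (p y))

theorem DifferentiableAlong.comp {W : Type*} [NormedAddCommGroup W] [NormedSpace ℝ W] {f : Z' → W}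
    {φ : Z → Z'} {z : Z} (hf : DifferentiableAlong E' f (φ z)) (hφ : SmoothMap E E' φ) :
    DifferentiableAlong E (fun y => f (φ y)) z :=
  fun P _ _ _ p hp x hx => hf P _ (hφ P p hp) x (by rw [hx])

theorem differentiableAlong_chart {e : PartialEquiv Z E} (he : e ∈ ConvenientManifold.charts)
    {z : Z} (hz : z ∈ e.source) (l : E →L[ℝ] ℝ) : DifferentiableAlong E (fun y => l (e y)) z :=
  fun _ _ _ _ _ hp x hx => ((hp e he).2 x (by rw [mem_preimage, hx]; exact hz) l).differentiableAt
    (by simp)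

/-- The derivative of a function along a smooth curve is the one along the straight line in a chart
with the same velocity. -/
theorem deriv_along_eq {W : Type*} [NormedAddCommGroup W] [NormedSpace ℝ W] {f : Z → W}
    {c : ℝ → Z} {s : ℝ} (hf : DifferentiableAlong E f (c s)) (hc : Smooth E c)
    {e : PartialEquiv Z E} (he : e ∈ ConvenientManifold.charts) (hs : c s ∈ e.source) {v : E}
    (hv : HasVelocity (fun r => e (c r)) v s) :
    deriv (fun r => f (c r)) s = deriv (fun r : ℝ => f (e.symm (e (c s) + r • v))) 0 := by
  have hN : (fun r : ℝ => s + r) ⁻¹' (c ⁻¹' e.source) ∈ 𝓝 0 :=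
    ((hc e he).1.preimage (continuous_const_add s)).mem_nhds (by simpa using hs)
  obtain ⟨χ, hχ, hχ1, hχ2⟩ := exists_contDiff_cutoff hN
  set c₁ : ℝ → E := fun r => e (c (s + χ r)) with hc₁
  have hsm : SmoothFamilyOn univ c₁ :=
    (hc e he).2.comp (contDiff_const.add hχ) fun x _ => hχ2 x
  have hv₁ : HasVelocity c₁ v 0 := by
    refine (hasVelocity_iff_shift.1 hv).congr ?_
    filter_upwards [hχ1] with x hx
    simp only [hc₁, hx]
  have h0 : c₁ 0 = e (c s) := by simp only [hc₁, hχ1.self_of_nhds, add_zero]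
  set h := Function.update (slope c₁ 0) 0 v with hh
  have hh0 : h 0 = v := Function.update_self _ _ _
  have hsh : SmoothFamilyOn univ h := smoothFamilyOn_update_slope hsm hv₁
  have hdiag : ∀ r, e (c s) + r • h r = c₁ r := by
    intro r
    rcases eq_or_ne r 0 with rfl | hr
    · rw [zero_smul, add_zero, h0]
    · rw [hh, Function.update_of_ne hr, slope, vsub_eq_sub, h0, sub_zero, smul_inv_smul₀ hr,
        add_sub_cancel]
  -- With `h` the difference quotient of the curve in the chart, this family is the curve itself on
  -- the diagonal, its tangent line on the slice where the second parameter is `0`, and constant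
  -- where the first is `0`. Hence the derivative `D` of `f` along it has `D (1, 1) = D (1, 0) + D
  -- (0, 1)` with `D (0, 1) = 0`.
  have hq : SmoothFamilyOn univ (fun p : ℝ × ℝ => e (c s) + p.1 • h p.2) := by
    intro x _ l
    simp only [map_add, map_smul, smul_eq_mul]
    exact contDiffAt_const.add (contDiffAt_fst.mul ((hsh x.2 trivial l).comp x contDiffAt_snd))
  obtain ⟨p, hp, hpq⟩ := exists_smooth_eventuallyEq he univ_mem hq (x₀ := (0, 0)) (by
    simpa using e.map_source hs)
  have hp0 : p (0, 0) = c s := by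
    rw [hpq.self_of_nhds]
    simpa using e.left_inv hs
  have hD := (hf _ p hp (0, 0) hp0).hasFDerivAt
  set D := fderiv ℝ (fun y => f (p y)) (0, 0)
  have t1 : Tendsto (fun r : ℝ => (r, r)) (𝓝 0) (𝓝 (0, 0)) :=
    (continuous_id.prodMk continuous_id).tendsto' _ _ rfl
  have t2 : Tendsto (fun r : ℝ => (r, (0 : ℝ))) (𝓝 0) (𝓝 (0, 0)) :=
    (continuous_id.prodMk continuous_const).tendsto' _ _ rfl
  have t3 : Tendsto (fun r : ℝ => ((0 : ℝ), r)) (𝓝 0) (𝓝 (0, 0)) :=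
    (continuous_const.prodMk continuous_id).tendsto' _ _ rfl
  have d1 : HasDerivAt (fun r => f (c r)) (D (1, 1)) s := by
    have := HasFDerivAt.comp_hasDerivAt (f := fun r : ℝ => (r, r)) (0 : ℝ) hD
      ((hasDerivAt_id _).prodMk (hasDerivAt_id _))
    have h2 : HasDerivAt (fun r => f (c (s + r))) (D (1, 1)) 0 := by
      refine this.congr_of_eventuallyEq ?_
      filter_upwards [hχ1, t1.eventually hpq, hN] with r h1 h2 h3
      simp only [Function.comp_apply]
      rw [h2, hdiag, hc₁]
      simp only
      rw [h1, e.left_inv h3]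
    have h3 := HasDerivAt.comp_sub_const (f := fun r => f (c (s + r))) s s (by simpa using h2)
    simpa using h3
  have d2 : HasDerivAt (fun r : ℝ => f (e.symm (e (c s) + r • v))) (D (1, 0)) 0 := by
    have := HasFDerivAt.comp_hasDerivAt (f := fun r : ℝ => (r, (0 : ℝ))) (0 : ℝ) hD
      ((hasDerivAt_id _).prodMk (hasDerivAt_const _ _))
    refine this.congr_of_eventuallyEq ?_
    filter_upwards [t2.eventually hpq] with r h2
    simp only [Function.comp_apply]
    rw [h2, hh0]
  have d3 : D (0, 1) = 0 := by
    have := HasFDerivAt.comp_hasDerivAt (f := fun r : ℝ => ((0 : ℝ), r)) (0 : ℝ) hD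
      ((hasDerivAt_const _ _).prodMk (hasDerivAt_id _))
    refine this.unique ((hasDerivAt_const (0 : ℝ) (f (c s))).congr_of_eventuallyEq ?_)
    filter_upwards [t3.eventually hpq] with r h2
    simp only [Function.comp_apply]
    rw [h2, zero_smul, add_zero, e.left_inv hs]
  rw [d1.deriv, d2.deriv, ← add_zero (D (1, 0)), ← d3, ← map_add]
  simp

/-- Both derivatives equal the one along the common tangent line in the chart that witnesses
`SameVelocity`. -/
theorem SameVelocity.deriv_eq {W : Type*} [NormedAddCommGroup W] [NormedSpace ℝ W] {f : Z → W}
    {c d : ℝ → Z} {s t : ℝ} (h : SameVelocity E c s d t) (hf : DifferentiableAlong E f (c s))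
    (hc : Smooth E c) (hd : Smooth E d) :
    deriv (fun r => f (c r)) s = deriv (fun r => f (d r)) t := by
  obtain ⟨hcd, e, he, hs, v, hv, hv'⟩ := h
  rw [deriv_along_eq hf hc he hs hv, deriv_along_eq (hcd ▸ hf) hd he (hcd ▸ hs) hv', hcd]

theorem exists_hasVelocity_chart [ConvenientSpace E] {c : ℝ → Z} {s : ℝ} (hc : Smooth E c)
    {e : PartialEquiv Z E} (he : e ∈ ConvenientManifold.charts) (hs : c s ∈ e.source) :
    ∃ v, HasVelocity (fun r => e (c r)) v s :=
  exists_hasVelocity ((hc e he).1.mem_nhds hs) (hc e he).2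

/-- Smooth curves that give the same derivatives to all functions have the same velocity, in any
chart. -/
theorem exists_velocity_of_deriv_eq [ConvenientSpace E] {c d : ℝ → Z} {s t : ℝ} (hcd : c s = d t)
    (hc : Smooth E c) (hd : Smooth E d)
    (h : ∀ f : Z → ℝ, DifferentiableAlong E f (c s) →
      deriv (fun r => f (c r)) s = deriv (fun r => f (d r)) t)
    {e : PartialEquiv Z E} (he : e ∈ ConvenientManifold.charts) (hs : c s ∈ e.source) :
    ∃ v, HasVelocity (fun r => e (c r)) v s ∧ HasVelocity (fun r => e (d r)) v t := by
  obtain ⟨v, hv⟩ := exists_hasVelocity_chart hc he hs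
  obtain ⟨w, hw⟩ := exists_hasVelocity_chart hd he (hcd ▸ hs)
  refine ⟨v, hv, ?_⟩
  have : v = w := eq_of_forall_dual_eq fun l => by
    rw [← hv.deriv l, ← hw.deriv l]
    exact h _ (differentiableAlong_chart he hs l)
  rwa [this]

/-- This chart-free form makes transitivity and the chain rule formal, although different instances
of `SameVelocity` may use different charts. For the converse, functions `l ∘ e` with `l` a
continuous functional suffice, since velocities exist in a convenient space and are separated by
functionals. -/
theorem sameVelocity_iff [ConvenientSpace E] {c d : ℝ → Z} {s t : ℝ} (hc : Smooth E c)
    (hd : Smooth E d) :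
    SameVelocity E c s d t ↔ c s = d t ∧ ∀ f : Z → ℝ, DifferentiableAlong E f (c s) →
      deriv (fun r => f (c r)) s = deriv (fun r => f (d r)) t := by
  refine ⟨fun h => ⟨h.1, fun f hf => h.deriv_eq hf hc hd⟩, fun ⟨hcd, h⟩ => ⟨hcd, ?_⟩⟩
  obtain ⟨e, he, hs⟩ := ConvenientManifold.exists_mem_source (E := E) (c s)
  exact ⟨e, he, hs, exists_velocity_of_deriv_eq hcd hc hd h he hs⟩

theorem SameVelocity.trans [ConvenientSpace E] {c d k : ℝ → Z} {s t r : ℝ}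
    (h : SameVelocity E c s d t) (h' : SameVelocity E d t k r) (hc : Smooth E c) (hd : Smooth E d)
    (hk : Smooth E k) : SameVelocity E c s k r := by
  rw [sameVelocity_iff hc hd] at h
  rw [sameVelocity_iff hd hk] at h'
  exact (sameVelocity_iff hc hk).2 ⟨h.1.trans h'.1, fun f hf =>
    (h.2 f hf).trans (h'.2 f (h.1 ▸ hf))⟩

theorem SameVelocity.congr {c c' d : ℝ → Z} {s t : ℝ} (h : SameVelocity E c s d t)
    (hc : c =ᶠ[𝓝 s] c') : SameVelocity E c' s d t := by
  obtain ⟨hcd, e, he, hs, v, hv, hv'⟩ := h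
  rw [hc.eq_of_nhds] at hcd hs
  exact ⟨hcd, e, he, hs, v, hv.congr (hc.fun_comp e), hv'⟩

theorem SameVelocity.comp [ConvenientSpace E] [ConvenientSpace E'] {c d : ℝ → Z} {s t : ℝ}
    (h : SameVelocity E c s d t) (hc : Smooth E c) (hd : Smooth E d) {φ : Z → Z'}
    (hφ : SmoothMap E E' φ) :
    SameVelocity E' (fun r => φ (c r)) s (fun r => φ (d r)) t := by
  obtain ⟨hcd, h⟩ := (sameVelocity_iff hc hd).1 h
  refine (sameVelocity_iff (hφ ℝ c hc) (hφ ℝ d hd)).2 ⟨by simp only [hcd], fun f hf => ?_⟩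
  exact h (fun y => f (φ y)) (hf.comp hφ)

theorem sameVelocity_shift_iff {c d : ℝ → Z} {s t : ℝ} :
    SameVelocity E (fun r => c (s + r)) 0 d t ↔ SameVelocity E c s d t := by
  unfold SameVelocity
  simp only [add_zero]
  refine and_congr_right fun _ => exists_congr fun e => and_congr_right fun _ =>
    and_congr_right fun _ => exists_congr fun v => and_congr_left fun _ => ?_
  exact (hasVelocity_iff_shift (c := fun r => e (c r))).symm

/-- A smooth curve with zero velocity is constant. -/
theorem eq_of_deriv_along_eq_zero [ConvenientSpace E] {y : ℝ → Z} (hy : Smooth E y) {S : Set ℝ}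
    (hS : Convex ℝ S)
    (h : ∀ t ∈ S, ∀ f : Z → ℝ, DifferentiableAlong E f (y t) → deriv (fun r => f (y r)) t = 0)
    {a b : ℝ} (ha : a ∈ S) (hb : b ∈ S) : y a = y b := by
  -- For the discrete topology continuity means local constancy, so connectedness of the convex set
  -- `S` finishes the proof. Local constancy is the mean value theorem for each functional in a
  -- chart.
  let _ : TopologicalSpace Z := ⊥
  have : DiscreteTopology Z := ⟨rfl⟩
  refine hS.isPreconnected.constant (fun t ht => ?_) ha hb
  rw [ContinuousWithinAt, nhds_discrete, tendsto_pure]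
  obtain ⟨e, he, hs⟩ := ConvenientManifold.exists_mem_source (E := E) (y t)
  obtain ⟨ε, hε, hB⟩ := Metric.isOpen_iff.1 (hy e he).1 t hs
  filter_upwards [mem_nhdsWithin_of_mem_nhds (Metric.ball_mem_nhds t hε), self_mem_nhdsWithin]
    with r hr hrS
  refine e.injOn (hB hr) hs (eq_of_forall_dual_eq fun l => ?_)
  have hconv : Convex ℝ (Metric.ball t ε ∩ S) := (convex_ball t ε).inter hS
  have := hconv.norm_image_sub_le_of_norm_hasDerivWithin_le (f := fun r => l (e (y r)))
    (f' := fun _ => 0) (C := 0) (fun x hx => by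
      have hd := differentiableAlong_chart he (hB hx.1) l
      have h1 := (hd ℝ y hy x rfl).hasDerivAt
      rw [h x hx.2 _ hd] at h1
      exact h1.hasDerivWithinAt) (fun x _ => by simp)
    ⟨Metric.mem_ball_self hε, ht⟩ ⟨hr, hrS⟩
  rw [zero_mul] at this
  exact sub_eq_zero.1 (norm_le_zero_iff.1 this)

end Manifold

/-! ### Trajectories in the group and on manifolds with a group action. -/

theorem deriv_diag_eq_add {W : Type*} [NormedAddCommGroup W] [NormedSpace ℝ W] {k : ℝ × ℝ → W}
    {t : ℝ} (hk : DifferentiableAt ℝ k (t, t)) :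
    deriv (fun r => k (r, r)) t = deriv (fun a => k (a, t)) t + deriv (fun b => k (t, b)) t := by
  have hD := hk.hasFDerivAt
  have d1 := HasFDerivAt.comp_hasDerivAt (f := fun r : ℝ => (r, r)) t hD
    ((hasDerivAt_id _).prodMk (hasDerivAt_id _))
  have d2 := HasFDerivAt.comp_hasDerivAt (f := fun r : ℝ => (r, t)) t hD
    ((hasDerivAt_id _).prodMk (hasDerivAt_const _ _))
  have d3 := HasFDerivAt.comp_hasDerivAt (f := fun r : ℝ => (t, r)) t hD
    ((hasDerivAt_const _ _).prodMk (hasDerivAt_id _))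
  refine d1.deriv.trans (Eq.trans ?_ (congrArg₂ (· + ·) d2.deriv d3.deriv).symm)
  rw [← map_add]
  simp

theorem SmoothMap.comp {E₁ E₂ E₃ Z₁ Z₂ Z₃ : Type*} [AddCommGroup E₁] [Module ℝ E₁]
    [TopologicalSpace E₁] [AddCommGroup E₂] [Module ℝ E₂] [TopologicalSpace E₂] [AddCommGroup E₃]
    [Module ℝ E₃] [TopologicalSpace E₃] [ConvenientManifold E₁ Z₁] [ConvenientManifold E₂ Z₂]
    [ConvenientManifold E₃ Z₃] {ψ : Z₂ → Z₃} {φ : Z₁ → Z₂} (hψ : SmoothMap E₂ E₃ ψ)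
    (hφ : SmoothMap E₁ E₂ φ) : SmoothMap E₁ E₃ (fun y => ψ (φ y)) :=
  fun P _ _ _ p hp => hψ P _ (hφ P p hp)

section Trajectory

variable {E Z F G : Type*} [AddCommGroup E] [Module ℝ E] [TopologicalSpace E]
  [ConvenientManifold E Z] [AddCommGroup F] [Module ℝ F] [TopologicalSpace F]
  [ConvenientManifold F G]

variable (E F G Z) in
/-- The action of `G` on `Z` is smooth. -/
def SmoothAction [SMul G Z] : Prop :=
  ∀ (P : Type) [NormedAddCommGroup P] [NormedSpace ℝ P] [FiniteDimensional ℝ P]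
    (p : P → G) (q : P → Z), Smooth F p → Smooth E q → Smooth E (fun y => p y • q y)

theorem SmoothAction.smoothMap_smul_const [SMul G Z] (h : SmoothAction E Z F G) (z : Z) :
    SmoothMap F E (fun A : G => A • z) :=
  fun P _ _ _ p hp => h P p _ hp (smooth_const E z)

theorem SmoothAction.smoothMap_const_smul [SMul G Z] (h : SmoothAction E Z F G) (A : G) :
    SmoothMap E E (fun z : Z => A • z) :=
  fun P _ _ _ q hq => h P _ q (smooth_const F A) hq

variable [Group G]

theorem Generator.exp_zero (H : Generator F G) : H.exp 0 = 1 := by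
  have := H.exp_add 0 0
  rw [add_zero] at this
  exact (mul_eq_left.1 this.symm)

variable (E) in
/-- The smooth curve `z` satisfies the differential equation given by the generators `H t` at all
times `t` in `S`. -/
def IsTrajectoryOn [MulAction G Z] (H : ℝ → Generator F G) (S : Set ℝ) (z : ℝ → Z) : Prop :=
  Smooth E z ∧ ∀ t ∈ S, SameVelocity E z t (fun s => (H t).exp s • z t) 0

theorem IsTrajectoryOn.mono [MulAction G Z] {H : ℝ → Generator F G} {S S' : Set ℝ} {z : ℝ → Z}
    (h : IsTrajectoryOn E H S z) (hS : S' ⊆ S) : IsTrajectoryOn E H S' z :=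
  ⟨h.1, fun t ht => h.2 t (hS ht)⟩

/-- The orbit map `A ↦ A • z` intertwines left multiplication with the action, so it pushes
trajectories forward. For `Z = G` this is the invariance of the equation under right translation. -/
theorem IsTrajectoryOn.smul_const [ConvenientSpace E] [ConvenientSpace F] [MulAction G Z]
    (hG : SmoothAction F G F G) (hZ : SmoothAction E Z F G) {H : ℝ → Generator F G} {S : Set ℝ}
    {g : ℝ → G} (hg : IsTrajectoryOn F H S g) (z : Z) :
    IsTrajectoryOn E H S (fun t => g t • z) := by
  refine ⟨hZ.smoothMap_smul_const z ℝ g hg.1, fun t ht => ?_⟩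
  have := (hg.2 t ht).comp hg.1 (hG.smoothMap_smul_const (g t) ℝ _ (H t).smooth)
    (hZ.smoothMap_smul_const z)
  simpa only [smul_assoc] using this

/-- Two trajectories, one in the group and one in a manifold on which the group acts, differ by a
constant. -/
theorem IsTrajectoryOn.inv_smul_eq [ConvenientSpace E] [ConvenientSpace F] [MulAction G Z]
    (hinv : SmoothMap F F (fun A : G => A⁻¹)) (hG : SmoothAction F G F G)
    (hZ : SmoothAction E Z F G) {H : ℝ → Generator F G} {S : Set ℝ} (hS : Convex ℝ S)
    {g : ℝ → G} (hg : IsTrajectoryOn F H S g) {z : ℝ → Z} (hz : IsTrajectoryOn E H S z) {a b : ℝ}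
    (ha : a ∈ S) (hb : b ∈ S) : (g a)⁻¹ • z a = (g b)⁻¹ • z b := by
  have hy : Smooth E (fun t => (g t)⁻¹ • z t) := hZ ℝ _ _ (hinv ℝ g hg.1) hz.1
  refine eq_of_deriv_along_eq_zero hy hS (fun t ht f hf => ?_) ha hb
  set w := (g t)⁻¹ • z t with hw
  have hginv : Smooth F (fun p : ℝ × ℝ => (g p.1)⁻¹) :=
    (hinv ℝ g hg.1).comp contDiff_fst
  have s1 : Smooth E (fun p : ℝ × ℝ => (g p.1)⁻¹ • z p.2) :=
    hZ _ _ _ hginv (hz.1.comp contDiff_snd)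
  -- The derivative of `(g r)⁻¹` is never computed. The family `s2` is constant on the diagonal, so
  -- its partial derivative through `(g r)⁻¹` is minus that through `g r`; the first is shared with
  -- `s1`, and the second equals the partial derivative of `s1` through `z`, because both curves
  -- follow the same generator.
  have s2 : Smooth E (fun p : ℝ × ℝ => (g p.1)⁻¹ • g p.2 • w) :=
    hZ _ _ _ hginv (hZ _ _ _ (hg.1.comp contDiff_snd) (smooth_const E w))
  have hgw : g t • w = z t := smul_inv_smul _ _
  have e1 := deriv_diag_eq_add (hf (ℝ × ℝ) _ s1 (t, t) rfl)
  have e2 := deriv_diag_eq_add (hf (ℝ × ℝ) _ s2 (t, t) (inv_smul_smul _ _))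
  simp only [inv_smul_smul, deriv_const, hgw] at e2
  have e3 : deriv (fun r => f ((g t)⁻¹ • z r)) t
      = deriv (fun s => f ((g t)⁻¹ • (H t).exp s • z t)) 0 :=
    (hz.2 t ht).deriv_eq (f := fun y => f ((g t)⁻¹ • y)) (hf.comp (hZ.smoothMap_const_smul _)) hz.1
      (hZ.smoothMap_smul_const _ ℝ _ (H t).smooth)
  have e4 : deriv (fun r => f ((g t)⁻¹ • g r • w)) t
      = deriv (fun s => f ((g t)⁻¹ • ((H t).exp s • g t) • w)) 0 := by
    have hφ : SmoothMap F E (fun A : G => (g t)⁻¹ • A • w) :=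
      (hZ.smoothMap_const_smul (g t)⁻¹).comp (hZ.smoothMap_smul_const w)
    have h0 : (g t)⁻¹ • g t • w = w := by simp
    exact (hg.2 t ht).deriv_eq (f := fun A => f ((g t)⁻¹ • A • w))
      (DifferentiableAlong.comp (φ := fun A : G => (g t)⁻¹ • A • w)
        (by simpa only [h0] using hf) hφ)
      hg.1 (hG.smoothMap_smul_const _ ℝ _ (H t).smooth)
  simp only [smul_assoc, hgw] at e4
  rw [e1, e3, ← e4]
  exact e2.symm

/-- Right translation makes `g₂` meet `g₁` at one point `m` of the overlap; constancy of the
quotient then makes them agree on the whole overlap. -/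
theorem IsTrajectoryOn.exists_glue [ConvenientSpace F]
    (hinv : SmoothMap F F (fun A : G => A⁻¹)) (hG : SmoothAction F G F G)
    {H : ℝ → Generator F G} {a b c d : ℝ} (hcb : c < b) {g₁ g₂ : ℝ → G} (hac : a ≤ c) (hbd : b ≤ d)
    (h₁ : IsTrajectoryOn F H (Ioo a b) g₁) (h₂ : IsTrajectoryOn F H (Ioo c d) g₂) :
    ∃ g : ℝ → G, IsTrajectoryOn F H (Ioo a d) g := by
  obtain ⟨m, hm⟩ := exists_between hcb
  set g₃ : ℝ → G := fun t => g₂ t • ((g₂ m)⁻¹ * g₁ m) with hg₃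
  have h₃ : IsTrajectoryOn F H (Ioo c d) g₃ := h₂.smul_const hG hG _
  have hm3 : g₃ m = g₁ m := by simp [hg₃]
  have heq : ∀ t ∈ Ioo c b, g₃ t = g₁ t := by
    intro t ht
    have := (h₁.mono (Ioo_subset_Ioo_left hac)).inv_smul_eq hinv hG hG (convex_Ioo c b)
      (h₃.mono (Ioo_subset_Ioo_right hbd)) ht hm
    rw [hm3, smul_eq_mul, smul_eq_mul, inv_mul_cancel] at this
    exact (inv_mul_eq_one.1 this).symm
  classical
  set g : ℝ → G := fun t => if t < m then g₁ t else g₃ t with hg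
  have hgl : ∀ t < b, g t = g₁ t := by
    intro t ht
    by_cases htm : t < m
    · simp only [hg, htm, if_true]
    · simp only [hg, htm, if_false]
      exact heq t ⟨hm.1.trans_le (not_lt.1 htm), ht⟩
  have hgr : ∀ t > c, g t = g₃ t := by
    intro t ht
    by_cases htm : t < m
    · simp only [hg, htm, if_true]
      exact (heq t ⟨ht, htm.trans hm.2⟩).symm
    · simp only [hg, htm, if_false]
  have hev1 : ∀ t < b, g =ᶠ[𝓝 t] g₁ := fun t ht => by
    filter_upwards [Iio_mem_nhds ht] with s hs using hgl s hs
  have hev3 : ∀ t > c, g =ᶠ[𝓝 t] g₃ := fun t ht => by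
    filter_upwards [Ioi_mem_nhds ht] with s hs using hgr s hs
  refine ⟨g, Smooth.congr_of_eventuallyEq fun t => ?_, fun t ht => ?_⟩
  · rcases lt_or_ge t b with h | h
    · exact ⟨g₁, h₁.1, hev1 t h⟩
    · exact ⟨g₃, h₃.1, hev3 t (hcb.trans_le h)⟩
  · rcases lt_or_ge t b with h | h
    · rw [hgl t h]
      exact (h₁.2 t ⟨ht.1, h⟩).congr (hev1 t h).symm
    · rw [hgr t (hcb.trans_le h)]
      exact (h₃.2 t ⟨hcb.trans_le h, ht.2⟩).congr (hev3 t (hcb.trans_le h)).symm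

/-- Local existence of trajectories in the group implies global existence. -/
theorem exists_isTrajectoryOn_univ [ConvenientSpace F]
    (hinv : SmoothMap F F (fun A : G => A⁻¹)) (hG : SmoothAction F G F G)
    {H : ℝ → Generator F G}
    (hloc : ∀ t : ℝ, ∃ δ > 0, ∃ g : ℝ → G, IsTrajectoryOn F H (Metric.ball t δ) g) :
    ∃ g : ℝ → G, IsTrajectoryOn F H univ g ∧ g 0 = 1 := by
  have hT : ∀ T > 0, ∃ g : ℝ → G, IsTrajectoryOn F H (Ioo (-T) T) g ∧ g 0 = 1 := by
    intro T hT
    choose ε hε γ hγ using hloc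
    obtain ⟨δ, hδ, hδ'⟩ := lebesgue_number_lemma_of_metric (isCompact_Icc (a := -T) (b := T))
      (c := fun t => Metric.ball t (ε t)) (fun _ => Metric.isOpen_ball)
      (fun t _ => mem_iUnion.2 ⟨t, Metric.mem_ball_self (hε t)⟩)
    have hδ2 : ∀ x ∈ Icc (-T) T, ∃ g : ℝ → G, IsTrajectoryOn F H (Ioo (x - δ) (x + δ)) g := by
      intro x hx
      obtain ⟨i, hi⟩ := hδ' x hx
      rw [Real.ball_eq_Ioo] at hi
      exact ⟨γ i, (hγ i).mono hi⟩
    -- With `δ` a Lebesgue number, there is a trajectory on the `δ`-ball around each point of `[-T,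
    -- T]`. Advancing by `δ / 2` leaves an overlap for gluing at each stage; the minimum keeps the
    -- centres inside the interval.
    have key : ∀ n : ℕ, ∃ b, min (-T + n * (δ / 2)) T < b ∧
        ∃ g : ℝ → G, IsTrajectoryOn F H (Ioo (-T - δ) b) g := by
      intro n
      induction n with
      | zero =>
        refine ⟨-T + δ, ?_, hδ2 (-T) ⟨le_rfl, by linarith⟩⟩
        exact (min_le_left _ _).trans_lt (by simpa using hδ)
      | succ n ih =>
        obtain ⟨b, hb, g, hg⟩ := ih
        set x := min (-T + n * (δ / 2)) T with hx
        have hxT : -T ≤ x := le_min (by nlinarith [n.cast_nonneg (α := ℝ)]) (by linarith)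
        have hstep : min (-T + (n + 1 : ℕ) * (δ / 2)) T ≤ x + δ / 2 := by
          rw [hx, ← min_add_add_right]
          refine min_le_min (by push_cast; linarith) (by linarith)
        rcases le_or_gt (x + δ) b with h | h
        · exact ⟨b, by linarith, g, hg⟩
        · obtain ⟨g', hg'⟩ := hδ2 x ⟨hxT, min_le_right _ _⟩
          exact ⟨x + δ, by linarith, IsTrajectoryOn.exists_glue hinv hG (by linarith)
            (by linarith) h.le hg hg'⟩
    obtain ⟨n, hn⟩ := exists_nat_gt (2 * T / (δ / 2))
    obtain ⟨b, hb, g, hg⟩ := key n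
    rw [div_lt_iff₀ (by positivity)] at hn
    rw [min_eq_right (by linarith)] at hb
    refine ⟨fun t => g t • (g 0)⁻¹, ((hg.mono (Ioo_subset_Ioo (by linarith) hb.le)).smul_const
      hG hG _), by simp⟩
  choose γ hγ hγ0 using fun n : ℕ => hT (n + 1) (by positivity)
  -- The solutions `γ n` on `(-(n + 1), n + 1)` agree where they overlap because all are `1` at time
  -- `0`. At time `t` the first one defined there is used.
  have hcons : ∀ (n : ℕ) (t : ℝ), |t| < n + 1 → γ ⌊|t|⌋₊ t = γ n t := by
    intro n t ht
    set k := ⌊|t|⌋₊ with hk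
    have hkt : |t| < k + 1 := Nat.lt_floor_add_one _
    have hkn : k ≤ n := by
      rw [← Nat.lt_add_one_iff, hk]
      exact (Nat.floor_lt (abs_nonneg t)).2 (by push_cast; exact ht)
    have hkn' : (k : ℝ) ≤ n := by exact_mod_cast hkn
    have hk0 : (0 : ℝ) < k + 1 := by positivity
    have := (hγ k).inv_smul_eq hinv hG hG (convex_Ioo _ _)
      ((hγ n).mono (Ioo_subset_Ioo (by linarith) (by linarith))) (abs_lt.1 hkt)
      (⟨by linarith, hk0⟩ : (0 : ℝ) ∈ Ioo (-((k : ℝ) + 1)) (k + 1))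
    rw [hγ0, hγ0, smul_eq_mul, smul_eq_mul, inv_mul_cancel] at this
    exact inv_mul_eq_one.1 this
  have hev : ∀ t : ℝ, (fun t => γ ⌊|t|⌋₊ t) =ᶠ[𝓝 t] γ ⌊|t|⌋₊ := by
    intro t
    filter_upwards [(isOpen_lt continuous_abs continuous_const).mem_nhds
      (Nat.lt_floor_add_one |t|)] with s hs
    exact hcons _ s hs
  refine ⟨fun t => γ ⌊|t|⌋₊ t, ⟨Smooth.congr_of_eventuallyEq fun t => ⟨_, (hγ _).1, hev t⟩,
    fun t _ => ?_⟩, hγ0 _⟩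
  exact ((hγ _).2 t (abs_lt.1 (Nat.lt_floor_add_one |t|))).congr (hev t).symm

/-- In a regular Lie group, smooth families of generators have trajectories. -/
theorem exists_isTrajectoryOn_of_isRegularLieGroup [ConvenientSpace F]
    (hG : SmoothAction F G F G)
    (hreg : IsRegularLieGroup F G) {H : ℝ → Generator F G} (hH : SmoothGenerators H) :
    ∃ g : ℝ → G, IsTrajectoryOn F H univ g ∧ g 0 = 1 := by
  obtain ⟨e, he, h1, v, hv, hvs⟩ := hH
  -- The parameter space `ℝ` is a dummy on which the curve does not depend; the solution is read off
  -- at parameter `0`.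
  obtain ⟨g, hg, hg'⟩ := hreg e he h1 ℝ (fun p => v p.2)
    (hvs.comp contDiff_snd (mapsTo_univ _ _))
  have hgs : Smooth F (fun t => g (0, t)) := hg.comp (contDiff_const.prodMk contDiff_id)
  refine ⟨fun t => g (0, t), ⟨hgs, fun t _ => ?_⟩, (hg' 0).1⟩
  have hsh : Smooth F (fun s => g (0, t + s)) := hgs.comp (contDiff_const.add contDiff_id)
  have hc : Smooth F (fun s => g (0, t + s) * (g (0, t))⁻¹) :=
    hG.smoothMap_smul_const (g (0, t))⁻¹ ℝ _ hsh
  have hsame : SameVelocity F (fun s => g (0, t + s) * (g (0, t))⁻¹) 0 (H t).exp 0 := by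
    refine ⟨?_, e, he, ?_, v t, (hg' 0).2 t, hv t⟩
    · simp [(H t).exp_zero]
    · simpa using h1
  have := hsame.comp hc (H t).smooth (hG.smoothMap_smul_const (g (0, t)))
  simp only [smul_eq_mul, inv_mul_cancel_right] at this
  exact sameVelocity_shift_iff.1 this

end Trajectory

/-! ### Local existence in finite dimensional groups. -/

/-- Solutions of a differential equation with a smooth right hand side are smooth. -/
theorem contDiffOn_of_hasDerivAt_comp {W : Type*} [NormedAddCommGroup W] [NormedSpace ℝ W]
    {f : W → W} {α : ℝ → W} {I : Set ℝ} (hI : IsOpen I)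
    (hα : ∀ t ∈ I, HasDerivAt α (f (α t)) t) (hf : ∀ t ∈ I, ContDiffAt ℝ ∞ f (α t)) :
    ContDiffOn ℝ ∞ α I := by
  rw [contDiffOn_infty]
  intro n
  induction n with
  | zero =>
    rw [Nat.cast_zero, contDiffOn_zero]
    exact fun t ht => (hα t ht).continuousAt.continuousWithinAt
  | succ n ih =>
    push_cast
    rw [contDiffOn_succ_iff_deriv_of_isOpen hI]
    refine ⟨fun t ht => (hα t ht).differentiableAt.differentiableWithinAt, by simp, ?_⟩
    have : ContDiffOn ℝ n (fun t => f (α t)) I := fun t ht =>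
      ((hf t ht).of_le (by exact_mod_cast le_top)).comp_contDiffWithinAt t (ih t ht)
    exact this.congr fun t ht => (hα t ht).deriv

theorem HasDerivAt.hasVelocity {E W : Type*} [AddCommGroup E] [Module ℝ E] [TopologicalSpace E]
    [NormedAddCommGroup W] [NormedSpace ℝ W] (L : E ≃L[ℝ] W) {c : ℝ → E} {w : W} {t : ℝ}
    (h : HasDerivAt (fun s => L (c s)) w t) : HasVelocity c (L.symm w) t := by
  rw [hasDerivAt_iff_tendsto_slope] at h
  refine ((L.symm.continuous.tendsto w).comp h).congr fun s => ?_
  simp [slope]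

theorem exists_continuousLinearEquiv_pi (F : Type*) [AddCommGroup F] [Module ℝ F]
    [TopologicalSpace F] [ConvenientSpace F] [FiniteDimensional ℝ F] :
    ∃ n : ℕ, Nonempty (F ≃L[ℝ] (Fin n → ℝ)) :=
  ⟨_, ⟨(Module.finBasis ℝ F).equivFun.toContinuousLinearEquiv⟩⟩

theorem SmoothFamilyOn.contDiffAt {F P : Type*} [AddCommGroup F] [Module ℝ F] [TopologicalSpace F]
    [NormedAddCommGroup P] [NormedSpace ℝ P] {n : ℕ} (L : F ≃L[ℝ] (Fin n → ℝ)) {U : Set P}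
    {p : P → F} (hp : SmoothFamilyOn U p) {x : P} (hx : x ∈ U) :
    ContDiffAt ℝ ∞ (fun y => L (p y)) x := by
  rw [contDiffAt_pi]
  intro i
  exact hp x hx ((ContinuousLinearMap.proj i).comp (L : F →L[ℝ] (Fin n → ℝ)))

/-- In a finite dimensional group, smooth families of generators have local trajectories. -/
theorem exists_isTrajectoryOn_ball {F G : Type*} [AddCommGroup F] [Module ℝ F]
    [TopologicalSpace F] [ConvenientSpace F] [FiniteDimensional ℝ F] [ConvenientManifold F G]
    [Group G] (hG : SmoothAction F G F G) {H : ℝ → Generator F G} (hH : SmoothGenerators H)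
    (t₀ : ℝ) : ∃ δ > 0, ∃ g : ℝ → G, IsTrajectoryOn F H (Metric.ball t₀ δ) g := by
  obtain ⟨e, he, h1, v, hv, hvs⟩ := hH
  obtain ⟨n, ⟨L⟩⟩ := exists_continuousLinearEquiv_pi F
  set x₀ : Fin n → ℝ := L (e 1) with hx₀
  have hLs : SmoothFamilyOn univ (fun x : Fin n → ℝ => L.symm x) := fun x _ l =>
    (l.comp (L.symm : (Fin n → ℝ) →L[ℝ] F)).contDiff.contDiffAt
  obtain ⟨θ, hθ, hθx⟩ := exists_smooth_eventuallyEq he univ_mem hLs (x₀ := x₀) (by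
    simpa [hx₀] using e.map_source h1)
  have hθ1 : θ x₀ = 1 := by
    rw [hθx.self_of_nhds, hx₀, L.symm_apply_apply, e.left_inv h1]
  have htgt : IsOpen ((fun x : Fin n → ℝ => L.symm x) ⁻¹' e.target) :=
    ConvenientManifold.isSmoothlyOpen_target e he _ _ hLs
  have hx₀t : x₀ ∈ (fun x : Fin n → ℝ => L.symm x) ⁻¹' e.target := by
    simpa [hx₀] using e.map_source h1
  -- the product in the chart
  set m : (Fin n → ℝ) × (Fin n → ℝ) → G := fun p => θ p.1 * θ p.2 with hm
  have hms : Smooth F m := hG _ _ _ (hθ.comp contDiff_fst) (hθ.comp contDiff_snd)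
  set μ : (Fin n → ℝ) × (Fin n → ℝ) → (Fin n → ℝ) := fun p => L (e (m p)) with hμ
  have hμs : ∀ p ∈ m ⁻¹' e.source, ContDiffAt ℝ ∞ μ p := fun p hp =>
    (hms e he).2.contDiffAt L hp
  set w : ℝ → (Fin n → ℝ) := fun t => L (v t) with hw
  have hws : ∀ t, ContDiffAt ℝ ∞ w t := fun t => hvs.contDiffAt L (mem_univ t)
  -- Time is adjoined as a first coordinate to make the system autonomous. The second component is
  -- the right-invariant vector field with value `w t` at the identity: the derivative of the
  -- product in its left factor at `x₀`.
  set f : ℝ × (Fin n → ℝ) → ℝ × (Fin n → ℝ) :=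
    fun p => (1, fderiv ℝ μ (x₀, p.2) (w p.1, 0)) with hf
  have hfs : ∀ p : ℝ × (Fin n → ℝ), m (x₀, p.2) ∈ e.source → ContDiffAt ℝ ∞ f p := by
    intro p hp
    refine contDiffAt_const.prodMk ?_
    have h2 : ContDiffAt ℝ ∞ (fderiv ℝ μ) (x₀, p.2) := (hμs _ hp).fderiv_right (by norm_cast)
    exact (ContDiffAt.comp p (f := fun p : ℝ × (Fin n → ℝ) => (x₀, p.2)) h2
      (contDiffAt_const.prodMk contDiffAt_snd)).clm_apply
      (((hws p.1).comp p contDiffAt_fst).prodMk contDiffAt_const)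
  have hm0 : m (x₀, x₀) ∈ e.source := by simpa [hm, hθ1] using h1
  obtain ⟨α, hα0, ε, hε, hα⟩ :=
    ((hfs (t₀, x₀) hm0).of_le (by
      exact_mod_cast le_top)).exists_forall_mem_closedBall_exists_eq_forall_mem_Ioo_hasDerivAt₀ t₀
  have hτ : ∀ t ∈ Ioo (t₀ - ε) (t₀ + ε), (α t).1 = t := by
    intro t ht
    have := (convex_Ioo (t₀ - ε) (t₀ + ε)).norm_image_sub_le_of_norm_hasDerivWithin_le
      (f := fun t => (α t).1 - t) (f' := fun _ => 0) (C := 0) (fun s hs => by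
        have h2 : HasDerivAt (fun t => (α t).1) 1 s :=
          (ContinuousLinearMap.fst ℝ ℝ (Fin n → ℝ)).hasFDerivAt.comp_hasDerivAt s (hα s hs)
        simpa using (h2.fun_sub (hasDerivAt_id s)).hasDerivWithinAt) (fun x _ => by simp)
      (⟨by linarith, by linarith⟩ : t₀ ∈ Ioo (t₀ - ε) (t₀ + ε)) ht
    rw [zero_mul, hα0] at this
    have h3 := norm_le_zero_iff.1 this
    simp only [sub_self, sub_zero] at h3
    exact sub_eq_zero.1 h3
  have hαc : ContinuousAt α t₀ := (hα t₀ ⟨by linarith, by linarith⟩).continuousAt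
  -- all conditions hold in a neighbourhood of `t₀`
  have hcx : Tendsto (fun t => (α t).2) (𝓝 t₀) (𝓝 x₀) := by
    have := hαc.snd.tendsto
    rwa [hα0] at this
  have hev : ∀ᶠ t in 𝓝 t₀, t ∈ Ioo (t₀ - ε) (t₀ + ε) ∧ m (x₀, (α t).2) ∈ e.source ∧
      (∀ᶠ x in 𝓝 (α t).2, θ x = e.symm (L.symm x)) ∧ L.symm (α t).2 ∈ e.target := by
    refine Eventually.and (Ioo_mem_nhds (by linarith) (by linarith))
      (Eventually.and ?_ (Eventually.and ?_ ?_))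
    · have hop := (hms e he).1.preimage (Continuous.prodMk_right x₀)
      exact hcx.eventually (hop.mem_nhds hm0)
    · exact hcx.eventually (eventually_eventually_nhds.2 hθx)
    · exact hcx.eventually (htgt.mem_nhds hx₀t)
  obtain ⟨η, hη, hηb⟩ := Metric.eventually_nhds_iff_ball.1 hev
  have hαs : ContDiffOn ℝ ∞ α (Metric.ball t₀ η) :=
    contDiffOn_of_hasDerivAt_comp Metric.isOpen_ball (fun t ht => hα t (hηb t ht).1)
      fun t ht => hfs _ (hηb t ht).2.1
  -- Reparametrising time by `χ` gives a curve smooth on all of `ℝ`, as a trajectory must be; the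
  -- equation is claimed only where `χ` is locally the identity.
  obtain ⟨χ, hχ, hχ1, hχ2⟩ := exists_contDiff_cutoff (Metric.ball_mem_nhds t₀ hη)
  set g : ℝ → G := fun t => θ (α (χ t)).2 with hg
  have hgs : Smooth F g := hθ.comp
    (contDiff_snd.comp (contDiff_iff_contDiffAt.2 fun t =>
      ((hαs _ (hχ2 t)).contDiffAt (Metric.isOpen_ball.mem_nhds (hχ2 t))).comp t hχ.contDiffAt))
  obtain ⟨δ, hδ, hδb⟩ := Metric.eventually_nhds_iff_ball.1
    ((eventually_eventually_nhds.2 hχ1).and (Metric.ball_mem_nhds t₀ hη))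
  refine ⟨δ, hδ, g, hgs, fun t ht => ?_⟩
  obtain ⟨hχt, htη⟩ := hδb t ht
  obtain ⟨htε, hmt, hθt, htt⟩ := hηb t htη
  have hgt : g t = θ (α t).2 := by simp only [hg, hχt.self_of_nhds]
  have hlineC : ContDiff ℝ ∞ (fun s : ℝ => x₀ + s • w t) :=
    contDiff_const.add (contDiff_id.smul contDiff_const)
  have hline0 : Tendsto (fun s : ℝ => x₀ + s • w t) (𝓝 0) (𝓝 x₀) :=
    hlineC.continuous.tendsto' _ _ (by simp)
  have hlined : HasDerivAt (fun s : ℝ => x₀ + s • w t) (w t) 0 := by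
    simpa using ((hasDerivAt_id (0 : ℝ)).smul_const (w t)).const_add x₀
  set b : ℝ → G := fun s => θ (x₀ + s • w t) with hb
  have hbs : Smooth F b := hθ.comp hlineC
  have hb0 : b 0 = 1 := by simp [hb, hθ1]
  set d : ℝ → G := fun s => b s • g t with hd
  have hds : Smooth F d := hG.smoothMap_smul_const (g t) ℝ _ hbs
  have hes : Smooth F (fun s => (H t).exp s • g t) :=
    hG.smoothMap_smul_const (g t) ℝ _ (H t).smooth
  -- `b` has the velocity of the one-parameter group
  have hbexp : SameVelocity F b 0 (H t).exp 0 := by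
    refine ⟨by rw [hb0, (H t).exp_zero], e, he, by rwa [hb0], v t, ?_, hv t⟩
    have : HasVelocity (fun s => e (b s)) (L.symm (w t)) 0 := by
      refine HasDerivAt.hasVelocity L (hlined.congr_of_eventuallyEq ?_)
      filter_upwards [hline0.eventually hθx, hline0.eventually (htgt.mem_nhds hx₀t)] with s h2 h3
      simp only [hb]
      rw [h2, e.right_inv h3, L.apply_symm_apply]
    simpa [hw] using this
  have hdexp : SameVelocity F d 0 (fun s => (H t).exp s • g t) 0 :=
    hbexp.comp hbs (H t).smooth (hG.smoothMap_smul_const (g t))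
  -- The chart line `b` replaces the one-parameter group, since it has the same velocity at the
  -- identity. The velocity of `b s • g t` in the chart is exactly the right hand side of the
  -- differential equation.
  have hgd : SameVelocity F g t d 0 := by
    have hd0 : d 0 = g t := by simp [hd, hb0]
    refine ⟨hd0.symm, e, he, ?_, L.symm (fderiv ℝ μ (x₀, (α t).2) (w t, 0)),
      HasDerivAt.hasVelocity L ?_, HasDerivAt.hasVelocity L ?_⟩
    · rw [hgt, hθt.self_of_nhds]
      exact e.map_target htt
    · have h2 : HasDerivAt (fun s => (α s).2) (fderiv ℝ μ (x₀, (α t).2) (w t, 0)) t := by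
        have := (ContinuousLinearMap.snd ℝ ℝ (Fin n → ℝ)).hasFDerivAt.comp_hasDerivAt t (hα t htε)
        simp only [hf, hτ t htε] at this
        exact this
      refine h2.congr_of_eventuallyEq ?_
      have hc2 : Tendsto (fun s => (α s).2) (𝓝 t) (𝓝 (α t).2) := h2.continuousAt
      filter_upwards [hχt, hc2.eventually hθt, hc2.eventually (htgt.mem_nhds htt)] with s h3 h4 h5
      simp only [hg]
      rw [h3, h4, e.right_inv h5, L.apply_symm_apply]
    · have hμd := ((hμs (x₀, (α t).2) hmt).differentiableAt (by simp)).hasFDerivAt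
      rw [show (x₀, (α t).2) = (x₀ + (0 : ℝ) • w t, (α t).2) by simp] at hμd
      have := HasFDerivAt.comp_hasDerivAt (f := fun s : ℝ => (x₀ + s • w t, (α t).2)) (0 : ℝ) hμd
        (hlined.prodMk (hasDerivAt_const _ _))
      simp only [zero_smul, add_zero] at this
      simp only [hd, hb, hgt]
      exact this
  exact hgd.trans hdexp hgs hds hes

/-! ### Quantized operators, dissipativity and the Schrödinger equation. -/

namespace QuantumSpace

variable {E Z : Type*} [AddCommGroup E] [Module ℝ E] [TopologicalSpace E]
  [ConvenientManifold E Z] {K : CoherentProduct E Z} {V : Type*} [NormedAddCommGroup V]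
  [InnerProductSpace ℂ V]

theorem carrier_induction (Q : QuantumSpace K V) {p : Q.carrier → Prop}
    (ket : ∀ z, p (Q.coherentState z)) (zero : p 0) (add : ∀ v w, p v → p w → p (v + w))
    (smul : ∀ (a : ℂ) v, p v → p (a • v)) (v : Q.carrier) : p v := by
  obtain ⟨v, hv⟩ := v
  refine Submodule.span_induction (p := fun v hv => p ⟨v, hv⟩) ?_ zero ?_ ?_ hv
  · rintro _ ⟨z, rfl⟩
    exact ket z
  · exact fun x y hx hy h1 h2 => add ⟨x, hx⟩ ⟨y, hy⟩ h1 h2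
  · exact fun a x hx h => smul a ⟨x, hx⟩ h

/-- Coherent states with smoothly varying labels are norm differentiable. -/
theorem differentiable_ket [CompleteSpace V] (Q : QuantumSpace K V) {z : ℝ → Z}
    (hz : Smooth E z) : Differentiable ℝ (fun t => Q.ket (z t)) := fun t =>
  differentiableAt_of_contDiff_gram _ (by
    simp only [Q.inner_ket]
    exact K.smooth (ℝ × ℝ) _ _ (hz.comp contDiff_fst) (hz.comp contDiff_snd)) t

variable {F G : Type*} [AddCommGroup F] [Module ℝ F] [TopologicalSpace F]
  [ConvenientManifold F G] [Group G] [StarMul G] [MulAction G Z] [CoherentLieGroup F G K]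

theorem inner_Gamma (Q : QuantumSpace K V) (A : G) (v w : Q.carrier) :
    inner ℂ (v : V) (Q.Gamma F A w : V) = inner ℂ (Q.Gamma F (star A) v : V) (w : V) := by
  induction v using Q.carrier_induction with
  | ket z =>
    rw [Gamma_coherentState]
    have := Q.inner_ket_linearCombination (CoherentLieGroup.adjoint F (K := K)) A z
      (Q.exists_linearCombination w).choose
    rw [(Q.exists_linearCombination w).choose_spec] at this
    exact this
  | zero => simp
  | add v v' h h' => simp only [map_add, Submodule.coe_add, inner_add_left, h, h']
  | smul a v h => simp only [map_smul, Submodule.coe_smul, inner_smul_left, h]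

theorem Gamma_mul (Q : QuantumSpace K V) (A B : G) (v : Q.carrier) :
    Q.Gamma F (A * B) v = Q.Gamma F A (Q.Gamma F B v) := by
  induction v using Q.carrier_induction with
  | ket z => simp only [Gamma_coherentState, mul_smul]
  | zero => simp
  | add v v' h h' => simp only [map_add, h, h']
  | smul a v h => simp only [map_smul, h]

theorem Gamma_one (Q : QuantumSpace K V) (v : Q.carrier) : Q.Gamma F (1 : G) v = v := by
  induction v using Q.carrier_induction with
  | ket z => simp only [Gamma_coherentState, one_smul]
  | zero => simp
  | add v v' h h' => simp only [map_add, h, h']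
  | smul a v h => simp only [map_smul, h]

variable [CompleteSpace V]

theorem differentiable_Gamma (Q : QuantumSpace K V) {A : ℝ → G} (hA : Smooth F A)
    (v : Q.carrier) : Differentiable ℝ (fun s => (Q.Gamma F (A s) v : V)) := by
  induction v using Q.carrier_induction with
  | ket z =>
    simp only [Gamma_coherentState]
    exact Q.differentiable_ket (CoherentLieGroup.smooth_smul K ℝ _ _ hA (smooth_const E z))
  | zero => simp
  | add v v' h h' =>
    simp only [map_add, Submodule.coe_add]
    exact h.add h'
  | smul a v h =>
    simp only [map_smul, Submodule.coe_smul]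
    exact h.const_smul a

theorem differentiable_Gamma_star (Q : QuantumSpace K V) (H : Generator F G) (v : Q.carrier) :
    Differentiable ℝ (fun s => (Q.Gamma F (star (H.exp s)) v : V)) :=
  have : LieStarGroup F G := CoherentLieGroup.toLieStarGroup K
  Q.differentiable_Gamma (LieStarGroup.smooth_star ℝ _ H.smooth) v

/-- The form equals `ħ / 2` times the derivative of `‖Γ(exp s)φ‖²` at `s = 0`, so its sign controls
the growth of norms. -/
theorem re_dGammaIm (Q : QuantumSpace K V) (hbar : ℝ) (H : Generator F G) (φ : Q.carrier) :
    (Q.dGammaIm hbar H (φ : V) φ).re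
      = hbar * (inner ℂ (φ : V) (deriv (fun s => (Q.Gamma F (H.exp s) φ : V)) 0)).re := by
  have : LieStarGroup F G := CoherentLieGroup.toLieStarGroup K
  set D := deriv (fun s => (Q.Gamma F (H.exp s) φ : V)) 0 with hD
  have hd : HasDerivAt (fun s => (Q.Gamma F (H.exp s) φ : V)) D 0 :=
    (Q.differentiable_Gamma H.smooth φ 0).hasDerivAt
  have e1 : Q.dGamma hbar H (φ : V) φ = Complex.I * hbar * inner ℂ (φ : V) D := by
    have : HasDerivAt (fun s => inner ℂ (Q.Gamma F (star (H.exp s)) φ : V) (φ : V))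
        (inner ℂ (φ : V) D) 0 := by
      simp only [← inner_Gamma]
      simpa using (hasDerivAt_const (0 : ℝ) (φ : V)).inner ℂ hd
    exact congrArg (fun x => Complex.I * (hbar : ℂ) * x) this.deriv
  have e2 : Q.dGamma hbar H.adjoint (φ : V) φ = Complex.I * hbar * -inner ℂ D (φ : V) := by
    have : HasDerivAt (fun s => inner ℂ (Q.Gamma F (star (star (H.exp (-s)))) φ : V) (φ : V))
        (-inner ℂ D (φ : V)) 0 := by
      simp only [star_star]
      have h1 : HasDerivAt (fun s => (Q.Gamma F (H.exp (-s)) φ : V)) (-D) 0 := by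
        have := HasDerivAt.scomp (h := fun s : ℝ => -s) (0 : ℝ) (by simpa using hd)
          (hasDerivAt_neg (0 : ℝ))
        simpa [Function.comp_def] using this
      simpa using h1.inner ℂ (hasDerivAt_const (0 : ℝ) (φ : V))
    exact congrArg (fun x => Complex.I * (hbar : ℂ) * x) this.deriv
  have e3 : Q.dGammaIm hbar H (φ : V) φ = (2 * Complex.I)⁻¹ *
      (Q.dGamma hbar H (φ : V) φ - Q.dGamma hbar H.adjoint (φ : V) φ) := rfl
  have e4 : (2 * Complex.I)⁻¹ * (Complex.I * hbar * inner ℂ (φ : V) D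
      - Complex.I * hbar * -inner ℂ D (φ : V))
      = ((hbar / 2 : ℝ) : ℂ) * (inner ℂ (φ : V) D + inner ℂ D (φ : V)) := by
    have := Complex.I_ne_zero
    push_cast
    field_simp
    ring
  rw [e3, e1, e2, e4, Complex.re_ofReal_mul, Complex.add_re, ← inner_conj_symm D (φ : V),
    Complex.conj_re]
  ring

/-- The quantization of a dissipative generator generates contractions of the quantum space. -/
theorem norm_Gamma_exp_le (Q : QuantumSpace K V) {hbar : ℝ} (hhbar : 0 < hbar)
    {H : Generator F G} (hH : ∀ φ : Q.carrier, (Q.dGammaIm hbar H (φ : V) φ).re ≤ 0)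
    {s : ℝ} (hs : 0 ≤ s) (φ : Q.carrier) : ‖(Q.Gamma F (H.exp s) φ : V)‖ ≤ ‖(φ : V)‖ := by
  set u : ℝ → V := fun s => (Q.Gamma F (H.exp s) φ : V) with hu
  have hd : ∀ s, HasDerivAt (fun s => (inner ℂ (u s) (u s)).re)
      (inner ℂ (u s) (deriv u s) + inner ℂ (deriv u s) (u s)).re s := by
    intro s
    have h1 := (Q.differentiable_Gamma H.smooth φ s).hasDerivAt
    exact Complex.reCLM.hasFDerivAt.comp_hasDerivAt s (h1.inner ℂ h1)
  have hder : ∀ s, (inner ℂ (u s) (deriv u s)).re ≤ 0 := by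
    intro s
    have h1 := hH (Q.Gamma F (H.exp s) φ)
    rw [re_dGammaIm] at h1
    -- The span is invariant under `Γ`, so by the group law the form may be evaluated at `Γ(exp
    -- s)φ`, which gives the derivative at every time `s`.
    have h2 : deriv (fun r => (Q.Gamma F (H.exp r) (Q.Gamma F (H.exp s) φ) : V)) 0
        = deriv u s := by
      simp only [← Gamma_mul, ← H.exp_add]
      have := deriv_comp_add_const u s 0
      rwa [zero_add] at this
    rw [h2] at h1
    exact nonpos_of_mul_nonpos_right h1 hhbar
  have hanti : Antitone (fun s => (inner ℂ (u s) (u s)).re) := by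
    refine antitone_of_deriv_nonpos (fun s => (hd s).differentiableAt) fun s => ?_
    rw [(hd s).deriv, Complex.add_re, ← inner_conj_symm (deriv u s) (u s), Complex.conj_re]
    linarith [hder s]
  have h0 : u 0 = φ := by simp only [hu, H.exp_zero, Gamma_one]
  have h3 : (inner ℂ (u s) (u s)).re ≤ (inner ℂ (u 0) (u 0)).re := hanti hs
  have h4 : ∀ v : V, (inner ℂ v v).re = ‖v‖ ^ 2 := fun v => (norm_sq_eq_re_inner (𝕜 := ℂ) v).symm
  rw [h0, h4, h4] at h3
  exact le_of_sq_le_sq h3 (norm_nonneg _)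

/-- Duality without leaving the span: for `w = Γ(A*)φ`, `‖w‖² = ⟨φ, Γ(A)w⟩ ≤ ‖φ‖ ‖w‖`. -/
theorem norm_Gamma_star_exp_le (Q : QuantumSpace K V) {hbar : ℝ} (hhbar : 0 < hbar)
    {H : Generator F G} (hH : ∀ φ : Q.carrier, (Q.dGammaIm hbar H (φ : V) φ).re ≤ 0)
    {s : ℝ} (hs : 0 ≤ s) (φ : Q.carrier) :
    ‖(Q.Gamma F (star (H.exp s)) φ : V)‖ ≤ ‖(φ : V)‖ := by
  set w := Q.Gamma F (star (H.exp s)) φ with hw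
  rcases (norm_nonneg (w : V)).eq_or_lt with h | h
  · rw [← h]
    exact norm_nonneg _
  · refine le_of_mul_le_mul_right ?_ h
    calc ‖(w : V)‖ * ‖(w : V)‖ = ‖inner ℂ (w : V) (w : V)‖ := by
          rw [inner_self_eq_norm_sq_to_K]
          simp [sq]
      _ = ‖inner ℂ (φ : V) (Q.Gamma F (H.exp s) w : V)‖ := by rw [Q.inner_Gamma (H.exp s) φ w]
      _ ≤ ‖(φ : V)‖ * ‖(Q.Gamma F (H.exp s) w : V)‖ := norm_inner_le_norm _ _
      _ ≤ ‖(φ : V)‖ * ‖(w : V)‖ := by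
          gcongr
          exact Q.norm_Gamma_exp_le hhbar hH hs w

/-- Dissipativity on the quantum space extends to the maximal domain of the quantization. -/
theorem re_inner_nonpos_of_dGamma_eq (Q : QuantumSpace K V) {hbar : ℝ} (hhbar : 0 < hbar)
    {H : Generator F G} (hH : ∀ φ : Q.carrier, (Q.dGammaIm hbar H (φ : V) φ).re ≤ 0) {δ χ : V}
    (h : (Complex.I * hbar) • Q.toAugmented χ = Q.dGamma hbar H δ) :
    (inner ℂ δ χ).re ≤ 0 := by
  have hder0 : ∀ v : Q.carrier, HasDerivAt
      (fun s => inner ℂ (Q.Gamma F (star (H.exp s)) v : V) δ) (inner ℂ (v : V) χ) 0 := by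
    intro v
    have h1 : Complex.I * hbar * inner ℂ (v : V) χ = Complex.I * hbar *
        deriv (fun s => inner ℂ (Q.Gamma F (star (H.exp s)) v : V) δ) 0 :=
      LinearMap.congr_fun h v
    have h2 : Complex.I * (hbar : ℂ) ≠ 0 :=
      mul_ne_zero Complex.I_ne_zero (by exact_mod_cast hhbar.ne')
    rw [mul_left_cancel₀ h2 h1]
    exact ((Q.differentiable_Gamma_star H v 0).inner ℂ (differentiableAt_const δ)).hasDerivAt
  -- The hypothesis gives the derivative at `s = 0` for every test vector; applying it to `Γ(exp s)*
  -- v` moves it to all `s`.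
  have hder : ∀ (v : Q.carrier) (s : ℝ), HasDerivAt
      (fun s => inner ℂ (Q.Gamma F (star (H.exp s)) v : V) δ)
      (inner ℂ (Q.Gamma F (star (H.exp s)) v : V) χ) s := by
    intro v s
    have h1 := hder0 (Q.Gamma F (star (H.exp s)) v)
    simp only [← Gamma_mul, ← star_mul, ← H.exp_add] at h1
    have := HasDerivAt.comp_sub_const
      (f := fun r => inner ℂ (Q.Gamma F (star (H.exp (s + r))) v : V) δ) s s (by simpa using h1)
    simpa using this
  have key : ∀ ε > 0, (inner ℂ δ χ).re ≤ 3 * ε * ‖δ‖ := by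
    intro ε hε
    obtain ⟨χ', hχ'mem, hχ'⟩ := Q.dense.exists_dist_lt χ hε
    rw [dist_eq_norm] at hχ'
    lift χ' to Q.carrier using hχ'mem
    have hcont : ContinuousAt (fun s => (Q.Gamma F (H.exp s) χ' : V)) 0 :=
      (Q.differentiable_Gamma H.smooth χ' 0).continuousAt
    obtain ⟨η, hη, hηb⟩ := Metric.continuousAt_iff.1 hcont ε hε
    simp only [H.exp_zero, Gamma_one, dist_eq_norm] at hηb
    -- The time `s₀` depends on `ε` and on the approximation `χ'` of `χ`, but not on the test vector
    -- `v`; this uniformity permits the passage to the limit in `v`.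
    set s₀ := η / 2 with hs₀
    have hs₀p : 0 < s₀ := by positivity
    have hclose : ∀ (v : Q.carrier), ∀ s ∈ Icc 0 s₀, (inner ℂ (v : V) χ).re - 3 * ε * ‖(v : V)‖
        ≤ (inner ℂ (Q.Gamma F (star (H.exp s)) v : V) χ).re := by
      intro v s hs
      set w := Q.Gamma F (star (H.exp s)) v with hw
      have n1 : ‖(w : V)‖ ≤ ‖(v : V)‖ := Q.norm_Gamma_star_exp_le hhbar hH hs.1 v
      have n2 : ‖(Q.Gamma F (H.exp s) χ' : V) - χ'‖ ≤ ε := by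
        refine (hηb ?_).le
        rw [sub_zero, Real.norm_eq_abs, abs_of_nonneg hs.1]
        linarith [hs.2]
      have e : inner ℂ (v : V) χ - inner ℂ (w : V) χ = inner ℂ (v : V) (χ - χ')
          - inner ℂ (w : V) (χ - χ') - inner ℂ (v : V) ((Q.Gamma F (H.exp s) χ' : V) - χ') := by
        simp only [inner_sub_right, inner_Gamma, ← hw]
        ring
      have i1 : ‖inner ℂ (v : V) (χ - χ')‖ ≤ ‖(v : V)‖ * ε :=
        (norm_inner_le_norm _ _).trans (by gcongr)
      have i2 : ‖inner ℂ (w : V) (χ - χ')‖ ≤ ‖(v : V)‖ * ε :=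
        (norm_inner_le_norm _ _).trans (by gcongr)
      have i3 : ‖inner ℂ (v : V) ((Q.Gamma F (H.exp s) χ' : V) - χ')‖ ≤ ‖(v : V)‖ * ε :=
        (norm_inner_le_norm _ _).trans (by gcongr)
      have i4 : ‖inner ℂ (v : V) χ - inner ℂ (w : V) χ‖ ≤ 3 * ε * ‖(v : V)‖ := by
        rw [e]
        refine (norm_sub_le _ _).trans ?_
        linarith [norm_sub_le (inner ℂ (v : V) (χ - χ')) (inner ℂ (w : V) (χ - χ'))]
      have i5 := (Complex.re_le_norm _).trans i4
      rw [Complex.sub_re] at i5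
      linarith
    -- The mean value inequality on `[0, s₀]` bounds the increment of `Re ⟨Γ(exp s)* v, δ⟩` from
    -- below, contractivity bounds its final value by `‖v‖ ‖δ‖`.
    have hcarrier : ∀ v : V, v ∈ Q.carrier →
        s₀ * ((inner ℂ v χ).re - 3 * ε * ‖v‖) ≤ ‖v‖ * ‖δ‖ - (inner ℂ v δ).re := by
      intro v hv
      lift v to Q.carrier using hv
      set k : ℝ → ℝ := fun s => (inner ℂ (Q.Gamma F (star (H.exp s)) v : V) δ).re with hk
      have hkd : ∀ s, HasDerivAt k (inner ℂ (Q.Gamma F (star (H.exp s)) v : V) χ).re s := fun s =>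
        Complex.reCLM.hasFDerivAt.comp_hasDerivAt s (hder v s)
      have hmvt := (convex_Icc 0 s₀).mul_sub_le_image_sub_of_le_deriv (f := k)
        (C := (inner ℂ (v : V) χ).re - 3 * ε * ‖(v : V)‖)
        (fun s _ => (hkd s).continuousAt.continuousWithinAt)
        (fun s _ => (hkd s).differentiableAt.differentiableWithinAt)
        (fun s hs => by
          rw [(hkd s).deriv]
          exact hclose v s (interior_subset hs)) 0 (left_mem_Icc.2 hs₀p.le) s₀
        (right_mem_Icc.2 hs₀p.le) hs₀p.le
      have hk0 : k 0 = (inner ℂ (v : V) δ).re := by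
        simp only [hk, H.exp_zero, star_one, Gamma_one]
      have hks : k s₀ ≤ ‖(v : V)‖ * ‖δ‖ := by
        refine (Complex.re_le_norm _).trans ((norm_inner_le_norm _ _).trans ?_)
        gcongr
        exact Q.norm_Gamma_star_exp_le hhbar hH hs₀p.le v
      rw [sub_zero, hk0] at hmvt
      linarith
    have hclosed : IsClosed {v : V |
        s₀ * ((inner ℂ v χ).re - 3 * ε * ‖v‖) ≤ ‖v‖ * ‖δ‖ - (inner ℂ v δ).re} := by
      refine isClosed_le ?_ ?_
      · exact continuous_const.mul ((Complex.continuous_re.comp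
          (continuous_id.inner continuous_const)).sub (continuous_const.mul continuous_norm))
      · exact (continuous_norm.mul continuous_const).sub (Complex.continuous_re.comp
          (continuous_id.inner continuous_const))
    -- At `v = δ` the right hand side `‖v‖ ‖δ‖ - Re ⟨v, δ⟩` vanishes, so the bound on `Re ⟨δ, χ⟩`
    -- follows on dividing by `s₀`.
    have hδ := hclosed.closure_subset_iff.2 hcarrier (Q.dense δ)
    rw [mem_ofPred_eq] at hδ
    have h4 : (inner ℂ δ δ).re = ‖δ‖ * ‖δ‖ := by
      rw [← sq]
      exact (norm_sq_eq_re_inner (𝕜 := ℂ) δ).symm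
    rw [h4, sub_self] at hδ
    linarith [nonpos_of_mul_nonpos_right hδ hs₀p]
  by_contra! hpos
  rcases (norm_nonneg δ).eq_or_lt with h0 | h0
  · have := key 1 one_pos
    rw [← h0] at this
    linarith
  · have := key ((inner ℂ δ χ).re / (6 * ‖δ‖)) (by positivity)
    have e : 3 * ((inner ℂ δ χ).re / (6 * ‖δ‖)) * ‖δ‖ = (inner ℂ δ χ).re / 2 := by
      field_simp
      norm_num
    rw [e] at this
    linarith

/-- The norm of the difference of two solutions is nonincreasing and starts at `0`. -/
theorem IsSchrodingerSolution.unique (Q : QuantumSpace K V) {hbar : ℝ} (hhbar : 0 < hbar)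
    {H : ℝ → Generator F G}
    (hH : ∀ t ≥ 0, ∀ φ : Q.carrier, (Q.dGammaIm hbar (H t) (φ : V) φ).re ≤ 0) {ψ₀ : V}
    {ψ ψ' : ℝ → V} (h : Q.IsSchrodingerSolution hbar H ψ₀ ψ)
    (h' : Q.IsSchrodingerSolution hbar H ψ₀ ψ') {t : ℝ} (ht : 0 ≤ t) : ψ t = ψ' t := by
  set δ : ℝ → V := fun t => ψ t - ψ' t with hδ
  have hd : ∀ t ≥ 0, ∃ χ : V, HasDerivWithinAt δ χ (Ici 0) t ∧ (inner ℂ (δ t) χ).re ≤ 0 := by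
    intro t ht
    obtain ⟨χ, h1, h2⟩ := h.2 t ht
    obtain ⟨χ', h1', h2'⟩ := h'.2 t ht
    refine ⟨χ - χ', h1.sub h1', Q.re_inner_nonpos_of_dGamma_eq hhbar (hH t ht) ?_⟩
    rw [map_sub, smul_sub, h2, h2', map_sub]
  have hanti : AntitoneOn (fun t => (inner ℂ (δ t) (δ t)).re) (Ici 0) := by
    have hn : ∀ t ≥ 0, ∃ d ≤ 0,
        HasDerivWithinAt (fun t => (inner ℂ (δ t) (δ t)).re) d (Ici 0) t := by
      intro t ht
      obtain ⟨χ, h1, h2⟩ := hd t ht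
      refine ⟨(inner ℂ (δ t) χ + inner ℂ χ (δ t)).re, ?_,
        Complex.reCLM.hasFDerivAt.comp_hasDerivWithinAt t (h1.inner ℂ h1)⟩
      rw [Complex.add_re, ← inner_conj_symm χ (δ t), Complex.conj_re]
      linarith
    refine antitoneOn_of_deriv_nonpos (convex_Ici 0) (fun t ht => ?_) (fun t ht => ?_)
      fun t ht => ?_
    · obtain ⟨d, _, h2⟩ := hn t ht
      exact h2.continuousWithinAt
    · obtain ⟨d, _, h2⟩ := hn t (interior_subset ht)
      exact (h2.mono interior_subset).differentiableWithinAt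
    · obtain ⟨d, h1, h2⟩ := hn t (interior_subset ht)
      rw [interior_Ici] at ht
      rw [(h2.hasDerivAt (Ici_mem_nhds ht)).deriv]
      exact h1
  have h4 : ∀ v : V, (inner ℂ v v).re = ‖v‖ ^ 2 := fun v => (norm_sq_eq_re_inner (𝕜 := ℂ) v).symm
  have h5 := hanti self_mem_Ici ht ht
  have h0 : δ 0 = 0 := by simp only [hδ, h.1, h'.1, sub_self]
  simp only [h4, h0, norm_zero] at h5
  have h6 : ‖δ t‖ = 0 := by
    have := norm_nonneg (δ t)
    nlinarith
  exact sub_eq_zero.1 (norm_eq_zero.1 h6)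

/-- Coherent states move along classical trajectories. -/
theorem isSchrodingerSolution_ket (Q : QuantumSpace K V) (hbar : ℝ) {H : ℝ → Generator F G}
    {z₀ : Z} {z : ℝ → Z} (hz : IsTrajectory E H z₀ z) :
    Q.IsSchrodingerSolution hbar H (Q.ket z₀) (fun t => Q.ket (z t)) := by
  obtain ⟨hzs, hz0, hzt⟩ := hz
  refine ⟨by simp only [hz0], fun t ht => ?_⟩
  have hu := (Q.differentiable_ket hzs t).hasDerivAt
  refine ⟨_, hu.hasDerivWithinAt, LinearMap.ext fun v => ?_⟩
  -- Both sides are antilinear functionals, so coherent states suffice as test vectors; on them the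
  -- adjoint relation moves the group element onto `z t` inside the kernel.
  induction v using Q.carrier_induction with
  | ket w =>
    have e : deriv (fun s => inner ℂ (Q.Gamma F (star ((H t).exp s)) (Q.coherentState w) : V)
        (Q.ket (z t))) 0 = inner ℂ (Q.ket w) (deriv (fun t => Q.ket (z t)) t) := by
      have h1 : (fun s => inner ℂ (Q.Gamma F (star ((H t).exp s)) (Q.coherentState w) : V)
          (Q.ket (z t))) = fun s => K.K w ((H t).exp s • z t) := by
        funext s
        rw [Gamma_coherentState, CoherentLieGroup.adjoint F]
        exact Q.inner_ket _ _
      have h2 : DifferentiableAlong E (fun y => K.K w y) (z t) := fun P _ _ _ p hp x _ =>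
        (K.smooth P _ _ (smooth_const E w) hp).differentiable (by simp) x
      rw [h1, ← (hzt t ht).deriv_eq h2 hzs
        (CoherentLieGroup.smooth_smul K ℝ _ _ (H t).smooth (smooth_const E (z t)))]
      have h3 := (hasDerivAt_const t (Q.ket w)).inner ℂ hu
      simp only [inner_zero_left, add_zero, Q.inner_ket] at h3
      exact h3.deriv
    exact (congrArg (fun x => Complex.I * (hbar : ℂ) * x) e).symm
  | zero => simp
  | add v w h1 h2 => rw [map_add, map_add, h1, h2]
  | smul a v h1 => rw [LinearMap.map_smulₛₗ, LinearMap.map_smulₛₗ, h1]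

end QuantumSpace

end CoherentManifolds

/-! ### The main theorem. -/

theorem theoremt {E Z F G V : Type*}
    [AddCommGroup E] [Module ℝ E] [TopologicalSpace E] [ConvenientSpace E]
    [ConvenientManifold E Z] (K : CoherentProduct E Z)
    [AddCommGroup F] [Module ℝ F] [TopologicalSpace F] [ConvenientSpace F]
    [ConvenientManifold F G] [Group G] [StarMul G] [MulAction G Z] [CoherentLieGroup F G K]
    [NormedAddCommGroup V] [InnerProductSpace ℂ V] [CompleteSpace V] (Q : QuantumSpace K V)
    (hbar : ℝ) (hhbar : 0 < hbar) (H : ℝ → Generator F G)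
    (hdissip : ∀ t ≥ 0, ∀ φ : Q.carrier, (Q.dGammaIm hbar (H t) (φ : V) φ).re ≤ 0) (z₀ : Z) :
    (∀ ψ ψ' : ℝ → V, Q.IsSchrodingerSolution hbar H (Q.ket z₀) ψ →
      Q.IsSchrodingerSolution hbar H (Q.ket z₀) ψ' → ∀ t ≥ 0, ψ t = ψ' t) ∧
    (∀ z : ℝ → Z, IsTrajectory E H z₀ z →
      Q.IsSchrodingerSolution hbar H (Q.ket z₀) (fun t => Q.ket (z t))) ∧
    ((FiniteDimensional ℝ F ∨ IsRegularLieGroup F G) → SmoothGenerators H →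
      ∃ z : ℝ → Z, IsTrajectory E H z₀ z ∧
        (∀ z' : ℝ → Z, IsTrajectory E H z₀ z' → ∀ t ≥ 0, z' t = z t) ∧
        Q.IsSchrodingerSolution hbar H (Q.ket z₀) (fun t => Q.ket (z t)) ∧
        ∀ ψ : ℝ → V, Q.IsSchrodingerSolution hbar H (Q.ket z₀) ψ →
          ∀ t ≥ 0, ψ t = Q.ket (z t)) := by
  refine ⟨fun ψ ψ' h h' t ht => h.unique Q hhbar hdissip h' ht,
    fun z hz => Q.isSchrodingerSolution_ket hbar hz, fun hfr hH => ?_⟩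
  have : LieStarGroup F G := CoherentLieGroup.toLieStarGroup K
  have hinv : SmoothMap F F (fun A : G => A⁻¹) := LieStarGroup.smooth_inv
  have hG : SmoothAction F G F G := LieStarGroup.smooth_mul
  have hZ : SmoothAction E Z F G := CoherentLieGroup.smooth_smul K
  obtain ⟨g, hg, hg0⟩ : ∃ g : ℝ → G, IsTrajectoryOn F H univ g ∧ g 0 = 1 := by
    rcases hfr with hfin | hreg
    · exact exists_isTrajectoryOn_univ hinv hG fun t => exists_isTrajectoryOn_ball hG hH t
    · exact exists_isTrajectoryOn_of_isRegularLieGroup hG hreg hH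
  have hz := hg.smul_const hG hZ z₀
  have htraj : IsTrajectory E H z₀ (fun t => g t • z₀) :=
    ⟨hz.1, by simp [hg0], fun t _ => hz.2 t (mem_univ t)⟩
  refine ⟨fun t => g t • z₀, htraj, fun z' hz' t ht => ?_,
    Q.isSchrodingerSolution_ket hbar htraj, fun ψ hψ t ht =>
      hψ.unique Q hhbar hdissip (Q.isSchrodingerSolution_ket hbar htraj) ht⟩
  -- The competitor obeys the equation only for `t ≥ 0`, so the constancy of `(g t)⁻¹ • z' t` is
  -- used on that half-line; its value at `0` is `z₀`.
  have hz'T : IsTrajectoryOn E H (Ici 0) z' := ⟨hz'.1, hz'.2.2⟩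
  have := (hg.mono (subset_univ _)).inv_smul_eq hinv hG hZ (convex_Ici 0) hz'T ht self_mem_Ici
  rw [hz'.2.1, hg0, inv_one, one_smul, inv_smul_eq_iff] at this
  exact this
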